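/- For $x,q\in\mathbb C$ put $(x;q)_n=\prod_{k=0}^{n-1}(1-xq^k)$, $(x_1,\dots,x_r;q)_n=\prod_i(x_i;q)_n$, and likewise $(x;q)_\infty=\prod_{k\ge0}(1-xq^k)$ when $|q|<1$; write $${}_{r+1}\phi_r\left(\begin{matrix}\alpha_0,\dots,\alpha_r\\ \beta_1,\dots,\beta_r\end{matrix};q,z\right)=\sum_{k\ge0}\frac{(\alpha_0,\dots,\alpha_r;q)_k}{(q,\beta_1,\dots,\beta_r;q)_k}z^k .$$ Let $[x]$ denote the integer part. A *monic Laurent polynomial of degree $n$* is a linear combination of the first $n+1$ terms of the sequence $1,z,z^{-1},z^2,z^{-2},\dots$ in which the $(n+1)$st term has coefficient $1$. Let $a,b,q$ be nonzero complex numbers, and let $$P_n(z)=P_n^{(a,b;q)}(z)=z^{-[n/2]}\,{}_2\phi_1\left(\begin{matrix}q^{-n},b/a\\ q^{1-n}/ab\end{matrix};q,\frac{qz}{b}\right),\qquad C_n=\begin{cases}1,& n\text{ even},\\ a^n(b/a;q)_n/(ab;q)_n,& n\text{ odd}.\end{cases}$$ **(1)** Let $n\ge 0$ with $(q;q)_n\ne0$,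 $(ab;q)_n\neq0$ and, if $n$ is odd, $(b/a;q)_n\ne0$. Then $P_n/C_n$ is a monic Laurent polynomial of degree $n$. From now on assume moreover $|q|<1$, $|b|<1$, and $abq^k\ne1$ for all integers $k\ge0$. With integration over the positively oriented unit circle, let $$w_{a}(z)=\frac{(qaz,1/az;q)_\infty}{(bz,b/z;q)_\infty},\qquad \mu_{a,b}(f)=\frac{(q,b^2;q)_\infty}{(qab,b/a;q)_\infty}\oint f(z)\,w_a(z)\,\frac{dz}{2\pi\mathrm i z}.$$ **(2)** Suppose $(b/a)q^k\neq1$ for all integers $k\ge0$. Then for all $m,n\ge 0$, $\mu_{a,b}(P_mP_n)=h_n\delta_{mn}$, where $$h_n=(-1)^na^{2[n/2]}\frac{(q,b^2,b/a;q)_n}{(ab;q)_n(abq;q)_{2[n/2]}(b/a;q)_{2[(n+1)/2]}}.$$ **(3)** (Relation to Pastro's orthogonality.) Under the assumptions of (2), put $p_n(z)=p_n^{(a,b;q)}(z)=z^{[n/2]}P_n(z)$. For every linear functional $L$ on the complex-valued functions on $\mathbb C\setminus\{0\}$ the following three conditions are equivalent: $L(P_mP_n)=0$ for all $m\ne n$;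 $L(z^{-k}p_n(z))=0$ for all $0\le k<n$; $L(p_m(z)p_n(1/z))=0$ for all $0\le n<m$. In the case of $\mu_{a,b}$ one has $$\mu_{a,b}(z^{-k}p_n(z))=0\quad(0\le k<n),\qquad \oint p_m(z)\,p_n(1/z)\,w_a(z)\,\frac{dz}{2\pi\mathrm iz}=0\quad(0\le n<m),$$ and, if also $b\ne qa$, $$\oint p_m^{(a,b;q)}(z)\,p_n^{(1/(qa),b;q)}(1/z)\,w_a(z)\,\frac{dz}{2\pi\mathrm iz}=0\quad(m\neq n).$$ **(4)** Let $c\neq0$ be such that $qbcq^k\ne1$ and $(b/c)q^k\neq1$ for all integers $k\ge0$. Let $m,n\ge0$, $M=[\frac m2]+[\frac n2]$ and $N=[\frac{m+1}2]+[\frac{n+1}2]$, and suppose that $(q^{-M}a/c;q)_{\min(m,n)}$ and $(q^{1-N}c/a;q)_{\min(m,n)}$ are nonzero. Then $$\mu_{c,b}(P_mP_n)=a^{M}\,\frac{(b^2;q)_m(b^2;q)_n(qc/a;q)_M(a/c;q)_N}{(ab;q)_m(ab;q)_n(qbc;q)_M(b/c;q)_N}\;{}_4\phi_3\left(\begin{matrix}q^{-m},q^{-n},ab,b/a\\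 b^2,q^{-M}a/c,q^{1-N}c/a\end{matrix};q,q\right).$$ -/

import Mathlib

noncomputable section

namespace PastroLaurent

/-- The `q`-shifted factorial `(x; q)_n = ∏_{k < n} (1 - x q^k)`. -/
def qPoch (x q : ℂ) (n : ℕ) : ℂ := ∏ k ∈ Finset.range n, (1 - x * q ^ k)

/-- The infinite `q`-shifted factorial `(x; q)_∞`, for `|q| < 1`. -/
def qPochInf (x q : ℂ) : ℂ := ∏' k : ℕ, (1 - x * q ^ k)

/-- The basic hypergeometric series `_{r+1}φ_r(as; bs; q, z)`, where `as` has one more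
entry than `bs`. -/
def basicHyp (as bs : List ℂ) (q z : ℂ) : ℂ :=
  ∑' k : ℕ, (as.map fun x => qPoch x q k).prod /
    (qPoch q q k * (bs.map fun y => qPoch y q k).prod) * z ^ k

/-- `P_n^{(a,b;q)}(z) = z^{-[n/2]} ₂φ₁(q^{-n}, b/a; q^{1-n}/(ab); q, qz/b)`. -/
def lauP (a b q : ℂ) (n : ℕ) (z : ℂ) : ℂ :=
  z ^ (-((n / 2 : ℕ) : ℤ)) *
    basicHyp [q ^ (-(n : ℤ)), b / a] [q ^ (1 - (n : ℤ)) / (a * b)] q (q * z / b)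

/-- The polynomial `p_n(z) = z^{[n/2]} P_n^{(a,b;q)}(z)`. -/
def polyP (a b q : ℂ) (n : ℕ) (z : ℂ) : ℂ := z ^ (n / 2) * lauP a b q n z

/-- The leading coefficient `C_n^{(a,b;q)}`. -/
def leadC (a b q : ℂ) (n : ℕ) : ℂ :=
  if Even n then 1 else a ^ n * qPoch (b / a) q n / qPoch (a * b) q n

/-- The squared norm `h_n`. -/
def normH (a b q : ℂ) (n : ℕ) : ℂ :=
  (-1) ^ n * a ^ (2 * (n / 2)) *
    (qPoch q q n * qPoch (b ^ 2) q n * qPoch (b / a) q n) /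
    (qPoch (a * b) q n * qPoch (a * b * q) q (2 * (n / 2)) *
      qPoch (b / a) q (2 * ((n + 1) / 2)))

/-- Exponents of the sequence `1, z, z⁻¹, z², z⁻², …`. -/
def lauExp (k : ℕ) : ℤ := if Even k then -((k / 2 : ℕ) : ℤ) else (((k + 1) / 2 : ℕ) : ℤ)

/-- `f` is (on `z ≠ 0`) a monic Laurent polynomial of degree `n`: a linear combination of the
first `n + 1` terms of `1, z, z⁻¹, z², z⁻², …` in which the last term has coefficient `1`. -/
def IsMonicLaurent (f : ℂ → ℂ) (n : ℕ) : Prop :=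
  ∃ c : ℕ → ℂ, c n = 1 ∧
    ∀ z : ℂ, z ≠ 0 → f z = ∑ k ∈ Finset.range (n + 1), c k * z ^ lauExp k

/-- `∮ f(z) dz / (2πiz)` over the positively oriented unit circle. -/
def circleMean (f : ℂ → ℂ) : ℂ :=
  (2 * (Real.pi : ℂ) * Complex.I)⁻¹ * ∮ z in C(0, 1), f z / z

/-- The weight `(qaz, 1/(az); q)_∞ / (bz, b/z; q)_∞`. -/
def weight (a b q z : ℂ) : ℂ :=
  (qPochInf (q * a * z) q * qPochInf (1 / (a * z)) q) /
    (qPochInf (b * z) q * qPochInf (b / z) q)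

/-- The functional `μ_{a,b}`. -/
def mu (a b q : ℂ) (f : ℂ → ℂ) : ℂ :=
  (qPochInf q q * qPochInf (b ^ 2) q) / (qPochInf (q * a * b) q * qPochInf (b / a) q) *
    circleMean (fun z => f z * weight a b q z)

end PastroLaurent

end

/-!
With `A = b/a`, `B = ab` (so `AB = b²`) and `[n, k]` the Gaussian binomial coefficient, rewriting
the terminating `₂φ₁` gives `z^{[n/2]} P_n(z) = R_n(A, B; az) / (ab; q)_n`, where
`R_n(A, B; u) = ∑_k [n, k] (A; q)_k (B; q)_{n-k} u^k` (`lauP_eq`, `polyP_eq`). Monicity is read off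
from the first and the last coefficient.

Everything about the functional rests on one integral: for `|b₁|, |b₂| < 1` and every `c ≠ 0`, the
weight `(qcz, 1/(cz); q)_∞ / (b₁z, b₂/z; q)_∞` has mean
`(b₁/c, qcb₂; q)_∞ / (q, b₁b₂; q)_∞` (`genMean_eval`). Moving the contour from `|z| = 1` to
`|z| = |q|`, together with the quasi-periodicity of the theta function in the numerator, gives
contiguous relations under `b₁ ↦ b₁q` and `b₂ ↦ b₂q` (`genMean_rec_left`, `genMean_rec_right`);
iterating them reduces to `b₁ = b₂ = 0`. For `|c| > 1` that constant is found from the case `b₁ = 0`,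
`b₂ = 1/c`, where the weight is entire, and it does not change when `c` is replaced by `cq`.

Multiplication of the weight by `(bz; q)_k (b/z; q)_l` only changes `b₁` and `b₂`, and
multiplication by a power of `z` only rescales `c`. So `R_m` is expanded in the `(bz; q)_k` and
`z⁻ⁿ R_n` in the `(b/z; q)_l` (`rogersSum_expand`, `rogersSum_reverse`). The resulting double sum
contains `(b²; q)_{k+l}`, whose linearization `qPoch_add_eq_sum` separates the two summations; each
of them is a `q`-Chu–Vandermonde sum (`double_sum_eval`). The outcome, `circleMean_rogersSum_mul`,
is, up to infinite products, a single sum of polynomials in `a/c`, and needs no genericity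
assumption on `c`. All statements about integrals are instances of it:

* dividing by `(τ; q)_{m+n}`, `τ = q^{-M} a/c`, turns the sum into the `₄φ₃`;
* for `c = a` its terms contain `(q^{j-M}; q)_{m+n-2j}`, which vanishes unless `j = m = n`;
* for `m = 0` it is a multiple of `(τ; q)_n`, whose zeros give the orthogonality of `p_n` to powers
  of `z`; the functions `p_n^{(1/(qa), b; q)}(1/z)` are covered as well, being multiples of
  `z⁻ⁿ p_n^{(qa, b; q)}(z)`.

The equivalence of the orthogonality conditions for an arbitrary functional is triangularity:
`P_0, …, P_{n-1}` span the same space as their leading monomials, and multiplying these by `P_n`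
yields exactly `z^{-k} p_n(z)` for `0 ≤ k < n`.
-/

noncomputable section

namespace PastroLaurent

open Finset
open scoped Topology

/-! ### Finite `q`-shifted factorials -/

@[simp] lemma qPoch_zero (x q : ℂ) : qPoch x q 0 = 1 := by simp [qPoch]

lemma qPoch_succ (x q : ℂ) (n : ℕ) : qPoch x q (n + 1) = qPoch x q n * (1 - x * q ^ n) := by
  simp [qPoch, prod_range_succ]

lemma qPoch_succ' (x q : ℂ) (n : ℕ) :
    qPoch x q (n + 1) = (1 - x) * qPoch (x * q) q n := by
  simp only [qPoch, prod_range_succ']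
  rw [mul_comm]
  congr 1
  · simp
  · exact prod_congr rfl fun k _ => by ring

lemma qPoch_add (x q : ℂ) (m n : ℕ) :
    qPoch x q (m + n) = qPoch x q m * qPoch (x * q ^ m) q n := by
  simp only [qPoch, prod_range_add]
  congr 1
  exact prod_congr rfl fun k _ => by ring

lemma qPoch_ne_zero_iff {x q : ℂ} {n : ℕ} :
    qPoch x q n ≠ 0 ↔ ∀ k < n, x * q ^ k ≠ 1 := by
  simp only [qPoch, prod_ne_zero_iff, mem_range, sub_ne_zero]
  exact forall₂_congr fun k _ => ne_comm

lemma qPoch_eq_zero {x q : ℂ} {n k : ℕ} (hk : k < n) (h : x * q ^ k = 1) : qPoch x q n = 0 := by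
  by_contra h0
  exact qPoch_ne_zero_iff.1 h0 k hk h

lemma qPoch_ne_zero_of_le {x q : ℂ} {m n : ℕ} (hmn : m ≤ n) (h : qPoch x q n ≠ 0) :
    qPoch x q m ≠ 0 :=
  qPoch_ne_zero_iff.2 fun k hk => qPoch_ne_zero_iff.1 h k (hk.trans_le hmn)

lemma qPoch_ne_zero_of_norm_lt {x q : ℂ} (hq : ‖q‖ < 1) (hx : ‖x‖ < 1) (n : ℕ) :
    qPoch x q n ≠ 0 := by
  refine qPoch_ne_zero_iff.2 fun k _ h => ?_
  have h1 : ‖x * q ^ k‖ < 1 := by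
    rw [norm_mul, norm_pow]
    exact (mul_le_of_le_one_right (norm_nonneg _)
      (pow_le_one₀ (norm_nonneg _) hq.le)).trans_lt hx
  rw [h, norm_one] at h1
  exact lt_irrefl _ h1

lemma choose_two_succ (n : ℕ) : (n + 1).choose 2 = n.choose 2 + n := by
  rw [Nat.choose_succ_succ' n 1, Nat.choose_one_right]; ring

lemma choose_two_add (m n : ℕ) : (m + n).choose 2 = m.choose 2 + n.choose 2 + m * n := by
  induction n with
  | zero => simp
  | succ n ih => rw [← add_assoc, choose_two_succ, ih, choose_two_succ]; ring

/-- Reversal of the order of the factors of `(τ q^{n-r}; q)_r`. -/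
lemma qPoch_reverse {τ q : ℂ} (hτ : τ ≠ 0) (hq : q ≠ 0) (n r : ℕ) (hr : r ≤ n) :
    (-τ) ^ r * q ^ (n.choose 2) * qPoch (q / (τ * q ^ n)) q r =
      q ^ ((n - r).choose 2) * qPoch (τ * q ^ (n - r)) q r := by
  induction r with
  | zero => simp
  | succ r ih =>
    obtain ⟨d, rfl⟩ := Nat.exists_eq_add_of_le hr
    have e1 : r + 1 + d - r = d + 1 := by omega
    have e2 : r + 1 + d - (r + 1) = d := by omega
    have ih' := ih (by omega)
    rw [e1] at ih'
    rw [e2, qPoch_succ, qPoch_succ' (τ * q ^ d)]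
    have h3 : (-τ) * (1 - q / (τ * q ^ (r + 1 + d)) * q ^ r) * q ^ d = 1 - τ * q ^ d := by
      have : q ^ (r + 1 + d) = q * q ^ r * q ^ d := by ring
      rw [this]
      have := pow_ne_zero r hq
      have := pow_ne_zero d hq
      field_simp
      ring
    rw [choose_two_succ, pow_add q (d.choose 2)] at ih'
    have hd := pow_ne_zero d hq
    apply mul_right_cancel₀ hd
    calc _ = ((-τ) ^ r * q ^ ((r + 1 + d).choose 2) * qPoch (q / (τ * q ^ (r + 1 + d))) q r) *
          ((-τ) * (1 - q / (τ * q ^ (r + 1 + d)) * q ^ r) * q ^ d) := by ring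
      _ = _ := by
        rw [ih', h3, mul_assoc τ, ← pow_succ]
        ring

/-! ### Gaussian binomial coefficients -/

/-- The Gaussian binomial coefficient, defined by the `q`-Pascal rule, hence meaningful for
every `q`. -/
def qBinom (q : ℂ) : ℕ → ℕ → ℂ
  | _, 0 => 1
  | 0, _ + 1 => 0
  | n + 1, k + 1 => qBinom q n k + q ^ (k + 1) * qBinom q n (k + 1)

@[simp] lemma qBinom_zero_right (q : ℂ) (n : ℕ) : qBinom q n 0 = 1 := by
  cases n <;> rfl

lemma qBinom_succ_succ (q : ℂ) (n k : ℕ) :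
    qBinom q (n + 1) (k + 1) = qBinom q n k + q ^ (k + 1) * qBinom q n (k + 1) := rfl

lemma qBinom_eq_zero (q : ℂ) {n k : ℕ} (h : n < k) : qBinom q n k = 0 := by
  induction n generalizing k with
  | zero => obtain ⟨k, rfl⟩ := Nat.exists_eq_succ_of_ne_zero h.ne'; rfl
  | succ n ih =>
    obtain ⟨k, rfl⟩ := Nat.exists_eq_succ_of_ne_zero (Nat.ne_zero_of_lt h)
    rw [Nat.succ_eq_add_one, qBinom_succ_succ, ih (by omega), ih (by omega)]
    simp

@[simp] lemma qBinom_self (q : ℂ) (n : ℕ) : qBinom q n n = 1 := by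
  induction n with
  | zero => rfl
  | succ n ih => rw [qBinom_succ_succ, ih, qBinom_eq_zero q n.lt_succ_self]; simp

/-- `[n, k] (q; q)_k = ∏_{i < k} (1 - q^{n - i})` for `n = d + k`, with the product written as
`(q^{d+1}; q)_k`. -/
lemma qBinom_mul_qPoch (q : ℂ) (d k : ℕ) :
    qBinom q (d + k) k * qPoch q q k = qPoch (q * q ^ d) q k := by
  induction d generalizing k with
  | zero => simp
  | succ d ihd =>
    induction k with
    | zero => simp
    | succ k ihk =>
      have h1 : qBinom q (d + 1 + (k + 1)) (k + 1) =
          qBinom q (d + 1 + k) k + q ^ (k + 1) * qBinom q (d + (k + 1)) (k + 1) := by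
        rw [← add_assoc, qBinom_succ_succ]; congr 3; ring
      have h2 := ihd (k + 1)
      rw [qPoch_succ' (q * q ^ d)] at h2
      rw [h1, add_mul, mul_assoc, h2]
      rw [qPoch_succ q, ← mul_assoc, ihk, qPoch_succ]
      have e : q * q ^ d * q = q * q ^ (d + 1) := by ring
      rw [e]
      ring

lemma qBinom_mul_qPoch_mul_qPoch (q : ℂ) {n k : ℕ} (h : k ≤ n) :
    qBinom q n k * (qPoch q q k * qPoch q q (n - k)) = qPoch q q n := by
  obtain ⟨d, rfl⟩ := Nat.exists_eq_add_of_le' h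
  rw [← mul_assoc, qBinom_mul_qPoch, Nat.add_sub_cancel, mul_comm, ← qPoch_add]

lemma qBinom_symm {q : ℂ} {n k : ℕ} (hq : qPoch q q n ≠ 0) (h : k ≤ n) :
    qBinom q n (n - k) = qBinom q n k := by
  have h1 := qBinom_mul_qPoch_mul_qPoch q h
  have h2 := qBinom_mul_qPoch_mul_qPoch q (Nat.sub_le n k)
  rw [Nat.sub_sub_self h, mul_comm (qPoch q q (n - k))] at h2
  exact mul_right_cancel₀ (mul_ne_zero (qPoch_ne_zero_of_le h hq)
    (qPoch_ne_zero_of_le (Nat.sub_le n k) hq)) (h2.trans h1.symm)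

/-- The second `q`-Pascal rule. -/
lemma qBinom_succ_succ' (q : ℂ) (n k : ℕ) (h : k ≤ n) :
    qBinom q (n + 1) (k + 1) = q ^ (n - k) * qBinom q n k + qBinom q n (k + 1) := by
  induction n generalizing k with
  | zero =>
    obtain rfl : k = 0 := by omega
    simp [qBinom_eq_zero]
  | succ n ih =>
    rcases k with _ | k
    · have := ih 0 (Nat.zero_le n)
      simp only [qBinom_zero_right, zero_add, Nat.sub_zero, mul_one] at this ⊢
      have e := qBinom_succ_succ q (n + 1) 0
      have e' := qBinom_succ_succ q n 0
      simp only [qBinom_zero_right, zero_add, pow_one] at e e'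
      linear_combination e - e' + q * this
    · rcases (Nat.lt_or_ge n (k + 1)) with hk | hk
      · obtain rfl : k = n := by omega
        rw [qBinom_eq_zero q (show k + 1 < k + 1 + 1 by omega)]
        simp
      · have h1 := ih k (by omega)
        have h2 := ih (k + 1) hk
        have e := qBinom_succ_succ q (n + 1) (k + 1)
        have e1 := qBinom_succ_succ q n k
        have e2 := qBinom_succ_succ q n (k + 1)
        obtain ⟨d, rfl⟩ := Nat.exists_eq_add_of_le hk
        rw [show k + 1 + d - k = d + 1 by omega] at h1
        rw [show k + 1 + d - (k + 1) = d by omega] at h2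
        rw [show k + 1 + d + 1 - (k + 1) = d + 1 by omega]
        linear_combination e + h1 + q ^ (k + 2) * h2 - q ^ (d + 1) * e1 - e2

/-- `[n, k] [k, j] = [n, j] [n - j, k - j]`. -/
lemma qBinom_mul_qBinom {q : ℂ} {n k j : ℕ} (hq : qPoch q q n ≠ 0) (hk : k ≤ n) (hj : j ≤ k) :
    qBinom q n k * qBinom q k j = qBinom q n j * qBinom q (n - j) (k - j) := by
  have h1 := qBinom_mul_qPoch_mul_qPoch q hk
  have h2 := qBinom_mul_qPoch_mul_qPoch q hj
  have h3 := qBinom_mul_qPoch_mul_qPoch q (hj.trans hk)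
  have h4 := qBinom_mul_qPoch_mul_qPoch q (show k - j ≤ n - j by omega)
  rw [show n - j - (k - j) = n - k by omega] at h4
  have n1 : qPoch q q j ≠ 0 := qPoch_ne_zero_of_le (hj.trans hk) hq
  have n2 : qPoch q q (k - j) ≠ 0 := qPoch_ne_zero_of_le (by omega) hq
  have n3 : qPoch q q (n - k) ≠ 0 := qPoch_ne_zero_of_le (by omega) hq
  rw [← h2] at h1
  rw [← h4] at h3
  apply mul_right_cancel₀ (mul_ne_zero (mul_ne_zero n1 n2) n3)
  linear_combination h1 - h3

/-! ### Terminating summations -/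

lemma sum_qBinom_succ (q : ℂ) (n : ℕ) (f : ℕ → ℂ) :
    ∑ k ∈ range (n + 2), qBinom q (n + 1) k * f k =
      ∑ k ∈ range (n + 1), qBinom q n k * (q ^ k * f k + f (k + 1)) := by
  have h : ∑ k ∈ range (n + 1), qBinom q n k * (q ^ k * f k) =
      ∑ k ∈ range (n + 1), q ^ (k + 1) * qBinom q n (k + 1) * f (k + 1) + f 0 := by
    rw [sum_range_succ', sum_range_succ _ n, qBinom_eq_zero q n.lt_succ_self]
    simp only [qBinom_zero_right, pow_zero, one_mul, mul_zero, zero_mul, add_zero]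
    congr 1
    exact sum_congr rfl fun k _ => by ring
  rw [sum_range_succ']
  simp only [mul_add, sum_add_distrib, h, qBinom_succ_succ, add_mul, qBinom_zero_right, one_mul]
  ring

lemma sum_qBinom_succ' (q : ℂ) (n : ℕ) (f : ℕ → ℂ) :
    ∑ k ∈ range (n + 2), qBinom q (n + 1) k * f k =
      ∑ k ∈ range (n + 1), qBinom q n k * (f k + q ^ (n - k) * f (k + 1)) := by
  have h : ∑ k ∈ range (n + 1), qBinom q n k * f k =
      ∑ k ∈ range (n + 1), qBinom q n (k + 1) * f (k + 1) + f 0 := by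
    rw [sum_range_succ', sum_range_succ _ n, qBinom_eq_zero q n.lt_succ_self]
    simp
  rw [sum_range_succ']
  simp only [mul_add, sum_add_distrib, h, qBinom_zero_right, one_mul]
  rw [add_right_comm, ← sum_add_distrib]
  congr 1
  refine sum_congr rfl fun k hk => ?_
  rw [qBinom_succ_succ' q n k (by simpa [Nat.lt_succ_iff] using hk)]
  ring

/-- The finite `q`-binomial theorem. -/
lemma sum_qBinom_mul_pow (q u : ℂ) (n : ℕ) :
    ∑ k ∈ range (n + 1), qBinom q n k * ((-1) ^ k * q ^ (k.choose 2) * u ^ k) = qPoch u q n := by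
  induction n generalizing u with
  | zero => simp
  | succ n ih =>
    rw [sum_qBinom_succ, qPoch_succ', ← ih, mul_sum]
    refine sum_congr rfl fun k _ => ?_
    rw [choose_two_succ]
    ring

/-- The first `q`-Chu–Vandermonde sum, cleared of denominators. -/
lemma sum_qBinom_chu (q A x : ℂ) (m : ℕ) :
    ∑ k ∈ range (m + 1), qBinom q m k *
        ((-1) ^ k * q ^ ((m - k).choose 2) * qPoch A q k * qPoch (x * q ^ k) q (m - k)) =
      q ^ (m.choose 2) * ∏ i ∈ range m, (A - x * q ^ i) := by
  induction m generalizing x with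
  | zero => simp
  | succ m ih =>
    have e : ∏ i ∈ range (m + 1), (A - x * q ^ i) =
        (A - x) * ∏ i ∈ range m, (A - x * q * q ^ i) := by
      rw [prod_range_succ', mul_comm]
      congr 1
      · simp
      · exact prod_congr rfl fun k _ => by ring
    rw [sum_qBinom_succ', e, choose_two_succ]
    rw [show q ^ (m.choose 2 + m) * ((A - x) * ∏ i ∈ range m, (A - x * q * q ^ i)) =
      q ^ m * (A - x) * (q ^ (m.choose 2) * ∏ i ∈ range m, (A - x * q * q ^ i)) by ring,
      ← ih, mul_sum]
    refine sum_congr rfl fun k hk => ?_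
    obtain ⟨d, rfl⟩ := Nat.exists_eq_add_of_le (show k ≤ m by simpa [Nat.lt_succ_iff] using hk)
    rw [show k + d + 1 - k = d + 1 by omega, show k + d + 1 - (k + 1) = d by omega,
      Nat.add_sub_cancel_left, choose_two_succ, qPoch_succ A, qPoch_succ']
    rw [show x * q ^ k * q = x * q * q ^ k by ring, show x * q ^ (k + 1) = x * q * q ^ k by ring]
    ring

/-- The second `q`-Chu–Vandermonde sum, cleared of denominators. -/
lemma sum_qBinom_chu' (q x Y : ℂ) (n : ℕ) :
    ∑ j ∈ range (n + 1), qBinom q n j *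
        (q ^ (j.choose 2) * x ^ j * (∏ i ∈ range j, (q ^ i - Y)) * qPoch (x * q ^ j) q (n - j)) =
      qPoch (x * Y) q n := by
  induction n generalizing x with
  | zero => simp
  | succ n ih =>
    rw [sum_qBinom_succ, qPoch_succ', show x * Y * q = x * q * Y by ring, ← ih, mul_sum]
    refine sum_congr rfl fun k hk => ?_
    obtain ⟨d, rfl⟩ := Nat.exists_eq_add_of_le (show k ≤ n by simpa [Nat.lt_succ_iff] using hk)
    rw [show k + d + 1 - k = d + 1 by omega, show k + d + 1 - (k + 1) = d by omega,
      Nat.add_sub_cancel_left, choose_two_succ, prod_range_succ, qPoch_succ']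
    rw [show x * q ^ k * q = x * q * q ^ k by ring, show x * q ^ (k + 1) = x * q * q ^ k by ring]
    ring

/-- For `l < j` both sides vanish. -/
lemma prod_pow_sub_pow (q : ℂ) (l j : ℕ) :
    ∏ i ∈ range j, (q ^ i - q ^ l) = qBinom q l j * qPoch q q j * q ^ (j.choose 2) := by
  rcases Nat.lt_or_ge l j with h | h
  · rw [qBinom_eq_zero q h, prod_eq_zero (mem_range.2 h) (sub_self _)]
    simp
  · obtain ⟨d, rfl⟩ := Nat.exists_eq_add_of_le' h
    rw [qBinom_mul_qPoch]
    clear h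
    induction j generalizing d with
    | zero => simp
    | succ j ih =>
      have := ih (d + 1)
      rw [show d + 1 + j = d + (j + 1) by ring] at this
      rw [prod_range_succ, this, qPoch_succ', choose_two_succ]
      rw [show q * q ^ (d + 1) = q * q ^ d * q by ring]
      ring

/-- Linearization of `(x; q)_{k+l}`, the decoupling device behind the `₄φ₃` in the values of the
functional. -/
lemma qPoch_add_eq_sum {q x : ℂ} (k l : ℕ) :
    qPoch (x * q ^ l) q k = ∑ j ∈ range (k + 1), qBinom q k j * (qBinom q l j *
      (qPoch q q j * q ^ (2 * j.choose 2) * x ^ j * qPoch (x * q ^ j) q (k - j))) := by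
  rw [← sum_qBinom_chu']
  refine sum_congr rfl fun j _ => ?_
  rw [prod_pow_sub_pow]
  ring

/-- `R_n(A, B; u) = ∑_k [n, k] (A; q)_k (B; q)_{n-k} u^k`. For `A = b/a`, `B = ab`, `u = az` this is
`p_n(z)` up to the factor `(ab; q)_n`. -/
def rogersSum (q A B : ℂ) (n : ℕ) (u : ℂ) : ℂ :=
  ∑ k ∈ range (n + 1), qBinom q n k * (qPoch A q k * qPoch B q (n - k) * u ^ k)

lemma rogersSum_reverse {q : ℂ} {n : ℕ} (hq : qPoch q q n ≠ 0) (A B : ℂ) {u : ℂ} (hu : u ≠ 0) :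
    rogersSum q A B n u = u ^ n * rogersSum q B A n u⁻¹ := by
  unfold rogersSum
  rw [← sum_range_reflect, mul_sum]
  refine sum_congr rfl fun k hk => ?_
  have hk : k ≤ n := by simpa [Nat.lt_succ_iff] using hk
  rw [show n + 1 - 1 - k = n - k by omega, Nat.sub_sub_self hk, qBinom_symm hq hk,
    inv_pow, ← div_eq_mul_inv (_ * _) (u ^ k), pow_sub₀ u hu hk]
  field_simp

/-- The expansion of `R_n(A, B; u)` in the shifted factorials `(Au; q)_k`. The first
Chu–Vandermonde sum expands `(B; q)_{n-k}`, and the finite `q`-binomial theorem then sums the powers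
of `u`. -/
lemma rogersSum_expand {q : ℂ} {n : ℕ} (hq : qPoch q q n ≠ 0) (A B u : ℂ) :
    q ^ (n.choose 2) * A ^ n * rogersSum q A B n u =
      ∑ k ∈ range (n + 1), qBinom q n k * ((-1) ^ k * q ^ ((n - k).choose 2) * qPoch A q k *
        qPoch (A * u) q k * qPoch (A * B * q ^ k) q (n - k)) := by
  have hf : ∀ r ∈ range (n + 1), qBinom q n r * ((-1) ^ r * q ^ ((n - r).choose 2) *
      qPoch A q r * qPoch (A * u) q r * qPoch (A * B * q ^ r) q (n - r)) =
      ∑ k ∈ Ico 0 (r + 1), qBinom q n r * qBinom q r k * ((-1) ^ (r + k) * q ^ (k.choose 2) *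
        q ^ ((n - r).choose 2) * (A * u) ^ k * qPoch A q r *
        qPoch (A * B * q ^ r) q (n - r)) := by
    intro r _
    rw [← sum_qBinom_mul_pow q (A * u), ← range_eq_Ico]
    simp only [mul_sum, sum_mul]
    exact sum_congr rfl fun k _ => by ring
  rw [sum_congr rfl hf, range_eq_Ico, ← sum_Ico_Ico_comm, ← range_eq_Ico, rogersSum, mul_sum]
  refine sum_congr rfl fun k hk => ?_
  obtain ⟨d, rfl⟩ := Nat.exists_eq_add_of_le (show k ≤ n by simpa [Nat.lt_succ_iff] using hk)
  have hchu := sum_qBinom_chu q (A * q ^ k) (A * B * q ^ k) d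
  have hprod : ∏ i ∈ range d, (A * q ^ k - A * B * q ^ k * q ^ i) =
      (A * q ^ k) ^ d * qPoch B q d := by
    rw [qPoch, ← card_range d, ← prod_const, card_range, ← prod_mul_distrib]
    exact prod_congr rfl fun i _ => by ring
  rw [hprod] at hchu
  rw [sum_Ico_eq_sum_range, show k + d + 1 - k = d + 1 by omega, Nat.add_sub_cancel_left,
    choose_two_add]
  calc _ = qBinom q (k + d) k * q ^ (k.choose 2) * (A * u) ^ k * qPoch A q k *
        (q ^ (d.choose 2) * ((A * q ^ k) ^ d * qPoch B q d)) := by ring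
    _ = _ := by
      rw [← hchu, mul_sum]
      refine sum_congr rfl fun i hi => ?_
      have hi : i ≤ d := by simpa [Nat.lt_succ_iff] using hi
      rw [qBinom_mul_qBinom hq (by omega) (by omega), show k + d - k = d by omega,
        show k + i - k = i by omega, show k + d - (k + i) = d - i by omega, qPoch_add A,
        show A * B * q ^ k * q ^ i = A * B * q ^ (k + i) by ring,
        show (-1 : ℂ) ^ (k + i + k) = (-1) ^ i by
          rw [show k + i + k = i + 2 * k by ring, pow_add, pow_mul]; simp]
      ring

/-! ### Infinite `q`-shifted factorials -/

lemma summable_norm_mul_pow {q : ℂ} (hq : ‖q‖ < 1) (x : ℂ) :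
    Summable fun k : ℕ => ‖-(x * q ^ k)‖ := by
  simp only [norm_neg, norm_mul, norm_pow]
  exact (summable_geometric_of_lt_one (norm_nonneg _) hq).mul_left _

lemma multipliable_qPochInf {q : ℂ} (hq : ‖q‖ < 1) (x : ℂ) :
    Multipliable fun k : ℕ => 1 - x * q ^ k := by
  simpa only [sub_eq_add_neg] using multipliable_one_add_of_summable (summable_norm_mul_pow hq x)

lemma qPoch_mul_qPochInf {q : ℂ} (hq : ‖q‖ < 1) (x : ℂ) (n : ℕ) :
    qPoch x q n * qPochInf (x * q ^ n) q = qPochInf x q := by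
  have h := multipliable_qPochInf hq (x * q ^ n)
  have e : (fun k : ℕ => 1 - x * q ^ n * q ^ k) = fun k => 1 - x * q ^ (k + n) := by
    ext k; ring
  rw [qPochInf, e]
  rw [e] at h
  exact Multipliable.prod_mul_tprod_nat_mul' (f := fun k : ℕ => 1 - x * q ^ k) h

lemma qPochInf_succ {q : ℂ} (hq : ‖q‖ < 1) (x : ℂ) :
    qPochInf x q = (1 - x) * qPochInf (x * q) q := by
  rw [← qPoch_mul_qPochInf hq x 1, qPoch_succ, qPoch_zero]; simp

lemma tendsto_qPoch {q : ℂ} (hq : ‖q‖ < 1) (x : ℂ) :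
    Filter.Tendsto (fun n => qPoch x q n) Filter.atTop (𝓝 (qPochInf x q)) :=
  (multipliable_qPochInf hq x).hasProd.tendsto_prod_nat

lemma qPochInf_ne_zero {q x : ℂ} (hq : ‖q‖ < 1) (hx : ∀ k : ℕ, x * q ^ k ≠ 1) :
    qPochInf x q ≠ 0 := by
  simp only [qPochInf, sub_eq_add_neg]
  refine tprod_one_add_ne_zero_of_summable (fun k => ?_) (summable_norm_mul_pow hq x)
  rw [← sub_eq_add_neg, sub_ne_zero]
  exact (hx k).symm

lemma qPochInf_ne_zero_of_norm_lt {q x : ℂ} (hq : ‖q‖ < 1) (hx : ‖x‖ < 1) :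
    qPochInf x q ≠ 0 :=
  qPochInf_ne_zero hq fun k =>
    qPoch_ne_zero_iff.1 (qPoch_ne_zero_of_norm_lt hq hx (k + 1)) k k.lt_succ_self

@[simp] lemma qPochInf_zero (q : ℂ) : qPochInf 0 q = 1 := by simp [qPochInf]

/-- The infinite product converges locally uniformly, so it is an entire function of `x`. -/
lemma differentiable_qPochInf {q : ℂ} (hq : ‖q‖ < 1) : Differentiable ℂ fun x => qPochInf x q := by
  intro x
  have hp : HasProdLocallyUniformlyOn (fun (k : ℕ) (y : ℂ) => 1 + -(y * q ^ k))
      (fun y => ∏' k : ℕ, (1 + -(y * q ^ k))) (Metric.ball (0 : ℂ) (‖x‖ + 1)) := by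
    refine Summable.hasProdLocallyUniformlyOn_nat_one_add
      (u := fun k => (‖x‖ + 1) * ‖q‖ ^ k) Metric.isOpen_ball
      ((summable_geometric_of_lt_one (norm_nonneg _) hq).mul_left _)
      (.of_forall fun k y hy => ?_) (fun k => by fun_prop)
    rw [norm_neg, norm_mul, norm_pow]
    gcongr
    simpa using (Metric.mem_ball.1 hy).le
  have hd := hp.differentiableOn (.of_forall fun s => by
    simpa [Finset.prod_fn] using DifferentiableOn.finsetProd (fun _ _ => by fun_prop))
    Metric.isOpen_ball
  simp only [qPochInf, sub_eq_add_neg]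
  exact hd.differentiableAt (Metric.isOpen_ball.mem_nhds (by simp))

lemma continuous_qPochInf {q : ℂ} (hq : ‖q‖ < 1) : Continuous fun x => qPochInf x q :=
  (differentiable_qPochInf hq).continuous

/-! ### Means over the unit circle -/

lemma circleMean_eq_circleAverage (f : ℂ → ℂ) : circleMean f = Real.circleAverage f 0 1 := by
  rw [Real.circleAverage_eq_circleIntegral one_ne_zero, circleMean]
  simp only [smul_eq_mul, sub_zero, div_eq_inv_mul]

lemma circleMean_congr {f g : ℂ → ℂ} (h : ∀ z : ℂ, ‖z‖ = 1 → f z = g z) :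
    circleMean f = circleMean g := by
  simp only [circleMean_eq_circleAverage]
  exact Real.circleAverage_congr_sphere fun z hz => h z (by simpa using hz)

lemma circleMean_const_mul (a : ℂ) (f : ℂ → ℂ) :
    circleMean (fun z => a * f z) = a * circleMean f := by
  simp only [circleMean_eq_circleAverage]
  exact Real.circleAverage_fun_smul (a := a)

lemma circleMean_sum {ι : Type*} (s : Finset ι) {f : ι → ℂ → ℂ}
    (h : ∀ i ∈ s, ContinuousOn (f i) (Metric.sphere 0 1)) :
    circleMean (fun z => ∑ i ∈ s, f i z) = ∑ i ∈ s, circleMean (f i) := by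
  simp only [circleMean_eq_circleAverage]
  exact Real.circleAverage_fun_sum fun i hi => (h i hi).circleIntegrable zero_le_one

lemma circleMean_sub {f g : ℂ → ℂ} (hf : ContinuousOn f (Metric.sphere 0 1))
    (hg : ContinuousOn g (Metric.sphere 0 1)) :
    circleMean (fun z => f z - g z) = circleMean f - circleMean g := by
  simp only [circleMean_eq_circleAverage]
  exact Real.circleAverage_fun_sub (hf.circleIntegrable zero_le_one)
    (hg.circleIntegrable zero_le_one)

/-- Cauchy's theorem for an annulus: the mean over the unit circle is unchanged when the circle
is rotated and shrunk inside the domain of holomorphy. -/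
lemma circleMean_comp_mul {f : ℂ → ℂ} {u : ℂ} (hu : u ≠ 0) (hu1 : ‖u‖ ≤ 1)
    (hf : ∀ z : ℂ, ‖u‖ ≤ ‖z‖ → ‖z‖ ≤ 1 → DifferentiableAt ℂ f z) :
    circleMean (fun z => f (u * z)) = circleMean f := by
  have hu0 : 0 < ‖u‖ := norm_pos_iff.2 hu
  have h1 : Real.circleAverage (fun z => f (u * z)) 0 1 = Real.circleAverage f 0 ‖u‖ := by
    rw [Real.circleAverage_eq_integral_add (R := ‖u‖) (Complex.arg u), Real.circleAverage]
    congr 1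
    refine intervalIntegral.integral_congr fun θ _ => ?_
    simp only [circleMap, zero_add, Complex.ofReal_one, one_mul]
    congr 1
    rw [Complex.ofReal_add, add_mul, Complex.exp_add]
    conv_lhs => rw [← Complex.norm_mul_exp_arg_mul_I u]
    ring
  have h2 : Real.circleAverage f 0 ‖u‖ = Real.circleAverage f 0 1 := by
    rw [Real.circleAverage_eq_circleIntegral hu0.ne', Real.circleAverage_eq_circleIntegral
      one_ne_zero,
      Complex.circleIntegral_sub_center_inv_smul_eq_of_differentiable_on_annulus_off_countable
        hu0 hu1 Set.countable_empty]
    · intro z hz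
      refine (hf z ?_ ?_).continuousAt.continuousWithinAt
      · simpa using hz.2
      · simpa using hz.1
    · intro z hz
      refine hf z ?_ ?_
      · simpa using (not_le.1 (fun h => hz.1.2 (by simpa using h))).le
      · have := hz.1.1
        simp only [Metric.mem_ball, dist_zero_right] at this
        exact this.le
  rw [circleMean_eq_circleAverage, circleMean_eq_circleAverage, h1, h2]

/-- The mean value property. -/
lemma circleMean_of_differentiable {f : ℂ → ℂ} (hf : Differentiable ℂ f) :
    circleMean f = f 0 := by
  rw [circleMean_eq_circleAverage]
  exact circleAverage_of_differentiable_on_off_countable (s := ∅) (by simp)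
    hf.continuous.continuousOn (fun z _ => hf z)

/-! ### The weight with two independent denominator parameters -/

/-- The weight `(qcz, 1/(cz); q)_∞ / (b₁z, b₂/z; q)_∞`. The two denominator parameters are kept
independent, so that multiplication by `(b₁z; q)_k (b₂/z; q)_l` stays within the family. -/
def genWeight (b₁ b₂ c q z : ℂ) : ℂ :=
  (qPochInf (q * c * z) q * qPochInf (1 / (c * z)) q) /
    (qPochInf (b₁ * z) q * qPochInf (b₂ / z) q)

lemma weight_eq_genWeight (a b q : ℂ) : weight a b q = genWeight b b a q := rfl

lemma genWeight_denom_ne_zero {b₁ b₂ q z : ℂ} (hq : ‖q‖ < 1) (h₁ : ‖b₁ * z‖ < 1)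
    (h₂ : ‖b₂ / z‖ < 1) : qPochInf (b₁ * z) q * qPochInf (b₂ / z) q ≠ 0 :=
  mul_ne_zero (qPochInf_ne_zero_of_norm_lt hq h₁) (qPochInf_ne_zero_of_norm_lt hq h₂)

lemma genWeight_mul_pow_left {b₁ b₂ q z : ℂ} (c : ℂ) (hq : ‖q‖ < 1) (h₁ : ‖b₁ * z‖ < 1)
    (k : ℕ) :
    genWeight (b₁ * q ^ k) b₂ c q z = qPoch (b₁ * z) q k * genWeight b₁ b₂ c q z := by
  have h := qPoch_mul_qPochInf hq (b₁ * z) k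
  have h0 := qPoch_ne_zero_of_norm_lt hq h₁ k
  rw [genWeight, genWeight, ← h, show b₁ * q ^ k * z = b₁ * z * q ^ k by ring]
  generalize qPochInf (b₁ * z * q ^ k) q = X at *
  generalize qPoch (b₁ * z) q k = Y at *
  field_simp

lemma genWeight_mul_pow_right {b₁ b₂ q z : ℂ} (c : ℂ) (hq : ‖q‖ < 1) (h₂ : ‖b₂ / z‖ < 1)
    (k : ℕ) :
    genWeight b₁ (b₂ * q ^ k) c q z = qPoch (b₂ / z) q k * genWeight b₁ b₂ c q z := by
  have h := qPoch_mul_qPochInf hq (b₂ / z) k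
  have h0 := qPoch_ne_zero_of_norm_lt hq h₂ k
  rw [genWeight, genWeight, ← h, show b₂ * q ^ k / z = b₂ / z * q ^ k by ring]
  generalize qPochInf (b₂ / z * q ^ k) q = X at *
  generalize qPoch (b₂ / z) q k = Y at *
  field_simp

lemma genWeight_mul_c {q c z : ℂ} (b₁ b₂ : ℂ) (hq : ‖q‖ < 1) (hq0 : q ≠ 0) (hc : c ≠ 0)
    (hz : z ≠ 0) : genWeight b₁ b₂ c q z = -(c * q * z) * genWeight b₁ b₂ (c * q) q z := by
  have h1 := qPochInf_succ hq (q * c * z)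
  have h2 := qPochInf_succ hq (1 / (c * q * z))
  rw [show 1 / (c * q * z) * q = 1 / (c * z) by field_simp] at h2
  rw [genWeight, genWeight, h1, h2, show q * (c * q) * z = q * c * z * q by ring]
  have e : -(c * q * z) * (1 - 1 / (c * q * z)) = 1 - q * c * z := by field_simp; ring
  rw [← e]
  ring

/-- Multiplication of the weight by a power of `z` amounts to a rescaling of `c`. -/
lemma genWeight_mul_pow_c {q c z : ℂ} (b₁ b₂ : ℂ) (hq : ‖q‖ < 1) (hq0 : q ≠ 0) (hc : c ≠ 0)
    (hz : z ≠ 0) (n : ℕ) : genWeight b₁ b₂ c q z =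
      (-c) ^ n * q ^ ((n + 1).choose 2) * z ^ n * genWeight b₁ b₂ (c * q ^ n) q z := by
  induction n with
  | zero => simp
  | succ n ih =>
    rw [ih, genWeight_mul_c b₁ b₂ hq hq0 (mul_ne_zero hc (pow_ne_zero n hq0)) hz,
      choose_two_succ (n + 1), mul_assoc c, ← pow_succ]
    ring

lemma differentiableAt_genWeight {b₁ b₂ q z : ℂ} (c : ℂ) (hq : ‖q‖ < 1) (hc : c ≠ 0)
    (hz : z ≠ 0) (h₁ : ‖b₁ * z‖ < 1) (h₂ : ‖b₂ / z‖ < 1) :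
    DifferentiableAt ℂ (genWeight b₁ b₂ c q) z := by
  have hd := differentiable_qPochInf hq
  have hcz := mul_ne_zero hc hz
  have d1 : DifferentiableAt ℂ (fun z => qPochInf (q * c * z) q) z :=
    (hd _).comp z (by fun_prop)
  have d2 : DifferentiableAt ℂ (fun z => qPochInf (1 / (c * z)) q) z :=
    (hd _).comp z (by fun_prop (disch := assumption))
  have d3 : DifferentiableAt ℂ (fun z => qPochInf (b₁ * z) q) z :=
    (hd _).comp z (by fun_prop)
  have d4 : DifferentiableAt ℂ (fun z => qPochInf (b₂ / z) q) z :=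
    (hd _).comp z (by fun_prop (disch := assumption))
  exact (d1.mul d2).div (d3.mul d4) (genWeight_denom_ne_zero hq h₁ h₂)

lemma continuousOn_genWeight {b₁ b₂ c q : ℂ} (hq : ‖q‖ < 1) (hc : c ≠ 0)
    (h₁ : ‖b₁‖ < 1) (h₂ : ‖b₂‖ < 1) :
    ContinuousOn (genWeight b₁ b₂ c q) (Metric.sphere 0 1) := by
  intro z hz
  have hz1 : ‖z‖ = 1 := by simpa using hz
  have hz0 : z ≠ 0 := by rintro rfl; simp at hz1
  refine (differentiableAt_genWeight c hq hc hz0 ?_ ?_).continuousAt.continuousWithinAt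
  · rwa [norm_mul, hz1, mul_one]
  · rwa [norm_div, hz1, div_one]

/-- The mean of `genWeight` over the unit circle. -/
def genMean (b₁ b₂ c q : ℂ) : ℂ := circleMean (genWeight b₁ b₂ c q)

lemma ne_zero_of_norm_one {z : ℂ} (hz : ‖z‖ = 1) : z ≠ 0 := by
  rintro rfl; simp at hz

/-- Shifting the contour from `|z| = 1` to `|z| = |q|`. -/
lemma genMean_shift {b₁ b₂ c q : ℂ} (hq : ‖q‖ < 1) (hq0 : q ≠ 0) (hc : c ≠ 0)
    (h₁ : ‖b₁‖ < 1) (h₂ : ‖b₂‖ < 1) :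
    genMean (b₁ * q) b₂ (c * q) q = genMean b₁ (b₂ * q) c q := by
  rw [genMean, genMean, ← circleMean_comp_mul (f := genWeight b₁ (b₂ * q) c q) hq0 hq.le]
  · refine circleMean_congr fun z hz => ?_
    have hz0 := ne_zero_of_norm_one hz
    rw [genWeight, genWeight]
    rw [show q * (c * q) * z = q * c * (q * z) by ring, show c * q * z = c * (q * z) by ring,
      show b₁ * q * z = b₁ * (q * z) by ring, show b₂ * q / (q * z) = b₂ / z by field_simp]
  · intro z hz hz1
    have hz' : 0 < ‖z‖ := (norm_pos_iff.2 hq0).trans_le hz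
    refine differentiableAt_genWeight c hq hc (norm_pos_iff.1 hz') ?_ ?_
    · rw [norm_mul]
      exact (mul_le_of_le_one_right (norm_nonneg _) hz1).trans_lt h₁
    · rw [norm_div, norm_mul, mul_div_assoc]
      exact (mul_le_of_le_one_right (norm_nonneg _) ((div_le_one hz').2 hz)).trans_lt h₂

lemma continuousOn_zpow_mul_genWeight {b₁ b₂ c q : ℂ} (hq : ‖q‖ < 1) (hc : c ≠ 0)
    (h₁ : ‖b₁‖ < 1) (h₂ : ‖b₂‖ < 1) (n : ℤ) :
    ContinuousOn (fun z => z ^ n * genWeight b₁ b₂ c q z) (Metric.sphere 0 1) := by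
  refine ContinuousOn.mul (fun z hz => ?_) (continuousOn_genWeight hq hc h₁ h₂)
  exact (continuousAt_zpow₀ z n
    (Or.inl (ne_zero_of_norm_one (by simpa using hz)))).continuousWithinAt

lemma genMean_mul_left {b₁ b₂ c q : ℂ} (hq : ‖q‖ < 1) (hc : c ≠ 0)
    (h₁ : ‖b₁‖ < 1) (h₂ : ‖b₂‖ < 1) :
    genMean (b₁ * q) b₂ c q = genMean b₁ b₂ c q -
      b₁ * circleMean (fun z => z ^ (1 : ℤ) * genWeight b₁ b₂ c q z) := by
  rw [genMean, genMean, ← circleMean_const_mul, ← circleMean_sub]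
  · refine circleMean_congr fun z hz => ?_
    have := genWeight_mul_pow_left (b₂ := b₂) c hq (z := z) (b₁ := b₁)
      (by rwa [norm_mul, hz, mul_one]) 1
    rw [pow_one] at this
    rw [this, qPoch_succ, qPoch_zero]
    simp
    ring
  · exact continuousOn_genWeight hq hc h₁ h₂
  · exact (continuousOn_zpow_mul_genWeight hq hc h₁ h₂ 1).const_mul b₁

lemma genMean_mul_right {b₁ b₂ c q : ℂ} (hq : ‖q‖ < 1) (hc : c ≠ 0)
    (h₁ : ‖b₁‖ < 1) (h₂ : ‖b₂‖ < 1) :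
    genMean b₁ (b₂ * q) c q = genMean b₁ b₂ c q -
      b₂ * circleMean (fun z => z ^ (-1 : ℤ) * genWeight b₁ b₂ c q z) := by
  rw [genMean, genMean, ← circleMean_const_mul, ← circleMean_sub]
  · refine circleMean_congr fun z hz => ?_
    have := genWeight_mul_pow_right (b₁ := b₁) c hq (z := z) (b₂ := b₂)
      (by rwa [norm_div, hz, div_one]) 1
    rw [pow_one] at this
    rw [this, qPoch_succ, qPoch_zero]
    simp
    ring
  · exact continuousOn_genWeight hq hc h₁ h₂
  · exact (continuousOn_zpow_mul_genWeight hq hc h₁ h₂ (-1)).const_mul b₂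

lemma circleMean_inv_mul_genWeight {c q : ℂ} (b₁ b₂ : ℂ) (hq : ‖q‖ < 1) (hq0 : q ≠ 0)
    (hc : c ≠ 0) : circleMean (fun z => z ^ (-1 : ℤ) * genWeight b₁ b₂ c q z) =
      -(c * q) * genMean b₁ b₂ (c * q) q := by
  rw [genMean, ← circleMean_const_mul]
  refine circleMean_congr fun z hz => ?_
  have hz0 := ne_zero_of_norm_one hz
  rw [genWeight_mul_c b₁ b₂ hq hq0 hc hz0, zpow_neg_one]
  field_simp

lemma circleMean_mul_genWeight {c q : ℂ} (b₁ b₂ : ℂ) (hq : ‖q‖ < 1) (hq0 : q ≠ 0)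
    (hc : c ≠ 0) : c * q * circleMean (fun z => z ^ (1 : ℤ) * genWeight b₁ b₂ (c * q) q z) =
      -genMean b₁ b₂ c q := by
  rw [genMean, ← circleMean_const_mul, ← neg_one_mul, ← circleMean_const_mul]
  refine circleMean_congr fun z hz => ?_
  have hz0 := ne_zero_of_norm_one hz
  rw [genWeight_mul_c b₁ b₂ hq hq0 hc hz0, zpow_one]
  ring

lemma norm_mul_lt_one {b q : ℂ} (hq : ‖q‖ < 1) (hb : ‖b‖ < 1) : ‖b * q‖ < 1 := by
  rw [norm_mul]
  exact (mul_le_of_le_one_right (norm_nonneg _) hq.le).trans_lt hb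

/-- The two expressions for the mean with `b₂q`, by `genMean_mul_right` and by `genMean_shift`,
involve the same mean for `cq`; it is eliminated. No division by `1 - qcb₂` takes place. -/
lemma genMean_rec_right {b₁ b₂ c q : ℂ} (hq : ‖q‖ < 1) (hq0 : q ≠ 0) (hc : c ≠ 0)
    (h₁ : ‖b₁‖ < 1) (h₂ : ‖b₂‖ < 1) :
    (1 - q * c * b₂) * genMean b₁ (b₂ * q) c q = (1 - b₁ * b₂) * genMean b₁ b₂ c q := by
  have hcq := mul_ne_zero hc hq0
  have e1 := genMean_mul_right hq hc h₁ h₂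
  rw [circleMean_inv_mul_genWeight b₁ b₂ hq hq0 hc] at e1
  have e2 := genMean_mul_left hq hcq h₁ h₂
  rw [genMean_shift hq hq0 hc h₁ h₂] at e2
  have e3 := circleMean_mul_genWeight b₁ b₂ hq hq0 hc
  linear_combination e1 - q * c * b₂ * e2 + b₁ * b₂ * e3

/-- The counterpart of `genMean_rec_right` for `b₁`. -/
lemma genMean_rec_left {b₁ b₂ c q : ℂ} (hq : ‖q‖ < 1) (hq0 : q ≠ 0) (hc : c ≠ 0)
    (h₁ : ‖b₁‖ < 1) (h₂ : ‖b₂‖ < 1) :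
    (1 - b₁ / c) * genMean (b₁ * q) b₂ c q = (1 - b₁ * b₂) * genMean b₁ b₂ c q := by
  -- the contour shift relates `c / q` to `c`
  obtain ⟨d, rfl⟩ : ∃ d, c = d * q := ⟨c / q, by field_simp⟩
  have hd : d ≠ 0 := left_ne_zero_of_mul hc
  have e1 := genMean_mul_left hq hc h₁ h₂
  have e2 := genMean_mul_right hq hd h₁ h₂
  rw [circleMean_inv_mul_genWeight b₁ b₂ hq hq0 hd, ← genMean_shift hq hq0 hd h₁ h₂] at e2
  have e3 := circleMean_mul_genWeight b₁ b₂ hq hq0 hd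
  have e4 : b₁ / (d * q) * (d * q) = b₁ := by field_simp
  set M1 := circleMean (fun z => z ^ (1 : ℤ) * genWeight b₁ b₂ (d * q) q z)
  linear_combination e1 - b₁ / (d * q) * e2 - b₁ / (d * q) * e3 -
    (b₂ * genMean b₁ b₂ (d * q) q - M1) * e4

/-! ### Evaluation of the mean of the weight -/

lemma continuous_genMean {c q : ℂ} (hq : ‖q‖ < 1) (hc : c ≠ 0) :
    Continuous fun p : {p : ℂ × ℂ // ‖p.1‖ < 1 ∧ ‖p.2‖ < 1} => genMean p.1.1 p.1.2 c q := by
  simp only [genMean, circleMean_eq_circleAverage, Real.circleAverage]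
  refine (intervalIntegral.continuous_parametric_intervalIntegral_of_continuous'
    ?_ _ _).const_smul _
  have hz : ∀ θ : ℝ, ‖circleMap 0 1 θ‖ = 1 := by simp
  have hz0 : ∀ θ : ℝ, circleMap 0 1 θ ≠ 0 := fun θ => ne_zero_of_norm_one (hz θ)
  have hc' : ∀ θ : ℝ, c * circleMap 0 1 θ ≠ 0 := fun θ => mul_ne_zero hc (hz0 θ)
  have hp := continuous_qPochInf hq
  have hm : Continuous fun x : {p : ℂ × ℂ // ‖p.1‖ < 1 ∧ ‖p.2‖ < 1} × ℝ => circleMap 0 1 x.2 :=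
    (continuous_circleMap 0 1).comp continuous_snd
  have h1 : Continuous fun x : {p : ℂ × ℂ // ‖p.1‖ < 1 ∧ ‖p.2‖ < 1} × ℝ => x.1.1.1 := by fun_prop
  have h2 : Continuous fun x : {p : ℂ × ℂ // ‖p.1‖ < 1 ∧ ‖p.2‖ < 1} × ℝ => x.1.1.2 := by fun_prop
  refine Continuous.div ?_ ?_ ?_
  · exact (hp.comp (continuous_const.mul hm)).mul
      (hp.comp (continuous_const.div (continuous_const.mul hm) fun x => hc' x.2))
  · exact (hp.comp (h1.mul hm)).mul (hp.comp (h2.div hm fun x => hz0 x.2))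
  · rintro ⟨⟨p, hp1, hp2⟩, θ⟩
    refine genWeight_denom_ne_zero hq ?_ ?_
    · rwa [norm_mul, hz, mul_one]
    · rwa [norm_div, hz, div_one]

lemma norm_mul_pow_lt_one {b q : ℂ} (hq : ‖q‖ < 1) (hb : ‖b‖ < 1) (k : ℕ) : ‖b * q ^ k‖ < 1 := by
  induction k with
  | zero => simpa
  | succ k ih => rw [pow_succ, ← mul_assoc]; exact norm_mul_lt_one hq ih

lemma tendsto_mul_pow {q : ℂ} (hq : ‖q‖ < 1) (b : ℂ) :
    Filter.Tendsto (fun k : ℕ => b * q ^ k) Filter.atTop (𝓝 0) := by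
  simpa using (tendsto_pow_atTop_nhds_zero_of_norm_lt_one hq).const_mul b

/-- Iteration of `genMean_rec_left`, with `b₁ q^k → 0`. -/
lemma genMean_eq_left {b₁ b₂ c q : ℂ} (hq : ‖q‖ < 1) (hq0 : q ≠ 0) (hc : c ≠ 0)
    (h₁ : ‖b₁‖ < 1) (h₂ : ‖b₂‖ < 1) :
    qPochInf (b₁ * b₂) q * genMean b₁ b₂ c q = qPochInf (b₁ / c) q * genMean 0 b₂ c q := by
  have hk : ∀ k : ℕ, qPoch (b₁ / c) q k * genMean (b₁ * q ^ k) b₂ c q =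
      qPoch (b₁ * b₂) q k * genMean b₁ b₂ c q := by
    intro k
    induction k with
    | zero => simp
    | succ k ih =>
      have := genMean_rec_left hq hq0 hc (norm_mul_pow_lt_one hq h₁ k) h₂
      rw [mul_assoc, ← pow_succ] at this
      rw [qPoch_succ, qPoch_succ]
      linear_combination (1 - b₁ * b₂ * q ^ k) * ih + qPoch (b₁ / c) q k * this
  have hlim := ((continuous_genMean hq hc).tendsto ⟨(0, b₂), by simpa⟩).comp
    (f := fun k : ℕ => ⟨(b₁ * q ^ k, b₂), norm_mul_pow_lt_one hq h₁ k, h₂⟩)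
    (x := Filter.atTop) (by
      rw [tendsto_subtype_rng]
      exact (tendsto_mul_pow hq b₁).prodMk_nhds tendsto_const_nhds)
  refine tendsto_nhds_unique ((tendsto_qPoch hq _).mul_const _)
    (Filter.Tendsto.congr hk ((tendsto_qPoch hq _).mul hlim))

/-- Iteration of `genMean_rec_right`, with `b₂ q^k → 0`. -/
lemma genMean_eq_right {b₂ c q : ℂ} (hq : ‖q‖ < 1) (hq0 : q ≠ 0) (hc : c ≠ 0) (h₂ : ‖b₂‖ < 1) :
    genMean 0 b₂ c q = qPochInf (q * c * b₂) q * genMean 0 0 c q := by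
  have hk : ∀ k : ℕ, qPoch (q * c * b₂) q k * genMean 0 (b₂ * q ^ k) c q =
      genMean 0 b₂ c q := by
    intro k
    induction k with
    | zero => simp
    | succ k ih =>
      have := genMean_rec_right hq hq0 hc (b₁ := 0) (by simp) (norm_mul_pow_lt_one hq h₂ k)
      rw [mul_assoc b₂, ← pow_succ] at this
      rw [qPoch_succ]
      linear_combination ih + qPoch (q * c * b₂) q k * this
  have h0 : ‖(0 : ℂ)‖ < 1 := by simp
  have hlim := ((continuous_genMean hq hc).tendsto ⟨(0, 0), h0, h0⟩).comp
    (f := fun k : ℕ => ⟨((0 : ℂ), b₂ * q ^ k), h0, norm_mul_pow_lt_one hq h₂ k⟩)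
    (x := Filter.atTop) (by
      rw [tendsto_subtype_rng]
      exact (tendsto_const_nhds (x := (0 : ℂ))).prodMk_nhds (tendsto_mul_pow hq b₂))
  exact tendsto_nhds_unique tendsto_const_nhds
    (Filter.Tendsto.congr hk ((tendsto_qPoch hq _).mul hlim))

/-- The constant term of the theta function. For `|c| > 1` it follows from the case `b₂ = 1/c`,
in which the weight agrees on the circle with an entire function; the other `c` are reached by the
quasi-periodicity in `c`. -/
lemma genMean_zero_zero {c q : ℂ} (hq : ‖q‖ < 1) (hq0 : q ≠ 0) (hc : c ≠ 0) :
    qPochInf q q * genMean 0 0 c q = 1 := by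
  have hlarge : ∀ d : ℂ, 1 < ‖d‖ → qPochInf q q * genMean 0 0 d q = 1 := by
    intro d hd
    have hd0 : d ≠ 0 := by rintro rfl; simp at hd; linarith
    have hb : ‖1 / d‖ < 1 := by rw [norm_div, norm_one]; exact (div_lt_one (by linarith)).2 hd
    have h := genMean_eq_right hq hq0 hd0 hb
    rw [show q * d * (1 / d) = q by field_simp] at h
    rw [← h, genMean]
    have e : circleMean (genWeight 0 (1 / d) d q) = circleMean fun z => qPochInf (q * d * z) q := by
      refine circleMean_congr fun z hz => ?_
      have hne : qPochInf (1 / d / z) q ≠ 0 :=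
        qPochInf_ne_zero_of_norm_lt hq (by rwa [norm_div, hz, div_one])
      rw [genWeight, zero_mul, qPochInf_zero, one_mul, ← div_div 1 d z,
        mul_div_cancel_right₀ _ hne]
    rw [e, circleMean_of_differentiable]
    · simp
    · exact (differentiable_qPochInf hq).comp (by fun_prop)
  have hshift : ∀ (k : ℕ) (d : ℂ), d ≠ 0 → genMean 0 0 (d * q ^ k) q = genMean 0 0 d q := by
    intro k
    induction k with
    | zero => simp
    | succ k ih =>
      intro d hd
      have := genMean_shift hq hq0 (mul_ne_zero hd (pow_ne_zero k hq0)) (b₁ := 0) (b₂ := 0)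
        (by simp) (by simp)
      rw [zero_mul] at this
      rw [pow_succ, ← mul_assoc, this, ih d hd]
  obtain ⟨k, hk⟩ := exists_pow_lt_of_lt_one (norm_pos_iff.2 hc) hq
  have hqk := pow_ne_zero k hq0
  rw [← hlarge (c / q ^ k), ← hshift k (c / q ^ k) (div_ne_zero hc hqk), div_mul_cancel₀ c hqk]
  rw [norm_div, norm_pow]
  exact (one_lt_div (pow_pos (norm_pos_iff.2 hq0) k)).2 hk

/-- The mean of the weight, for all parameters with `|b₁|, |b₂| < 1`. -/
lemma genMean_eval {b₁ b₂ c q : ℂ} (hq : ‖q‖ < 1) (hq0 : q ≠ 0) (hc : c ≠ 0)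
    (h₁ : ‖b₁‖ < 1) (h₂ : ‖b₂‖ < 1) :
    qPochInf q q * qPochInf (b₁ * b₂) q * genMean b₁ b₂ c q =
      qPochInf (b₁ / c) q * qPochInf (q * c * b₂) q := by
  rw [mul_assoc, genMean_eq_left hq hq0 hc h₁ h₂, genMean_eq_right hq hq0 hc h₂]
  linear_combination qPochInf (b₁ / c) q * qPochInf (q * c * b₂) q * genMean_zero_zero hq hq0 hc

/-! ### The mean of a product of two Rogers-type sums -/

/-- The Chu–Vandermonde sum with an additional factor `[k, j]`: by `[m, k] [k, j] =
[m, j] [m - j, k - j]` it is the same sum with `m - j` in place of `m`. -/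
lemma sum_qBinom_mul_qBinom_chu {q : ℂ} {m : ℕ} (hq : qPoch q q m ≠ 0) (A x : ℂ) (j : ℕ) :
    q ^ (j.choose 2) * ∑ k ∈ range (m + 1), qBinom q m k * ((-1) ^ k * q ^ ((m - k).choose 2) *
        qPoch A q k * qPoch (x * q ^ k) q (m - k)) * qBinom q k j =
      qBinom q m j * ((-1) ^ j * qPoch A q j * q ^ (m.choose 2) *
        ∏ i ∈ range (m - j), (A - x * q ^ i)) := by
  rcases Nat.lt_or_ge m j with hj | hj
  · rw [qBinom_eq_zero q hj, zero_mul, sum_eq_zero, mul_zero]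
    intro k hk
    rw [qBinom_eq_zero q (show k < j by have := mem_range.1 hk; omega), mul_zero]
  · obtain ⟨d, rfl⟩ := Nat.exists_eq_add_of_le hj
    rw [add_assoc, sum_range_add, sum_eq_zero, zero_add, Nat.add_sub_cancel_left]
    · have hchu := sum_qBinom_chu q (A * q ^ j) (x * q ^ j) d
      have hprod : ∏ i ∈ range d, (A * q ^ j - x * q ^ j * q ^ i) =
          q ^ (j * d) * ∏ i ∈ range d, (A - x * q ^ i) := by
        rw [pow_mul, ← card_range d, ← prod_const, card_range, ← prod_mul_distrib]
        exact prod_congr rfl fun i _ => by ring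
      rw [hprod] at hchu
      rw [choose_two_add]
      calc _ = q ^ (j.choose 2) * (qBinom q (j + d) j * (-1) ^ j * qPoch A q j *
            (q ^ (d.choose 2) * (q ^ (j * d) * ∏ i ∈ range d, (A - x * q ^ i)))) := by
            rw [← hchu]
            congr 1
            rw [mul_sum]
            refine sum_congr rfl fun i hi => ?_
            have hi : i ≤ d := by simpa [Nat.lt_succ_iff] using hi
            have e := qBinom_mul_qBinom hq (show j + i ≤ j + d by omega)
              (show j ≤ j + i by omega)
            rw [Nat.add_sub_cancel_left, Nat.add_sub_cancel_left] at e
            rw [show j + d - (j + i) = d - i by omega, qPoch_add A, pow_add (-1 : ℂ),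
              show x * q ^ (j + i) = x * q ^ j * q ^ i by ring]
            linear_combination ((-1) ^ j * (-1) ^ i * q ^ ((d - i).choose 2) * qPoch A q j *
              qPoch (A * q ^ j) q i * qPoch (x * q ^ j * q ^ i) q (d - i)) * e
        _ = _ := by ring
    · intro k hk
      rw [qBinom_eq_zero q (mem_range.1 hk), mul_zero]

lemma qPoch_mul_qPoch_sub (x q : ℂ) {k m : ℕ} (h : k ≤ m) :
    qPoch x q k * qPoch (x * q ^ k) q (m - k) = qPoch x q m := by
  rw [← qPoch_add, Nat.add_sub_cancel' h]

/-- The double sum produced by the two expansions of `R_m` and `R_n`: linearization decouples the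
two summation variables, after which both sums are of Chu–Vandermonde type. -/
lemma double_sum_eval {q X : ℂ} {m n : ℕ} (hm : qPoch q q m ≠ 0) (hn : qPoch q q n ≠ 0)
    (hX : ∀ k, qPoch X q k ≠ 0) (A B x y : ℂ) :
    ∑ k ∈ range (m + 1), ∑ l ∈ range (n + 1),
      (qBinom q m k * ((-1) ^ k * q ^ ((m - k).choose 2) * qPoch A q k *
        qPoch (x * q ^ k) q (m - k)) * qPoch (X * q ^ k) q (m - k)) *
      (qBinom q n l * ((-1) ^ l * q ^ ((n - l).choose 2) * qPoch B q l *
        qPoch (y * q ^ l) q (n - l)) * qPoch (X * q ^ l) q (n - l)) * qPoch X q (l + k) =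
    qPoch X q m * qPoch X q n * (q ^ (m.choose 2) * q ^ (n.choose 2)) *
      ∑ j ∈ range (m + 1), qBinom q m j * qBinom q n j * (qPoch q q j * X ^ j / qPoch X q j *
        (qPoch A q j * qPoch B q j) * ((∏ i ∈ range (m - j), (A - x * q ^ i)) *
          ∏ i ∈ range (n - j), (B - y * q ^ i))) := by
  set f : ℕ → ℂ := fun k => qBinom q m k * ((-1) ^ k * q ^ ((m - k).choose 2) * qPoch A q k *
        qPoch (x * q ^ k) q (m - k)) with hf
  set g : ℕ → ℂ := fun l => qBinom q n l * ((-1) ^ l * q ^ ((n - l).choose 2) * qPoch B q l *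
        qPoch (y * q ^ l) q (n - l)) with hg
  have hterm : ∀ k ∈ range (m + 1), ∀ l ∈ range (n + 1),
      f k * qPoch (X * q ^ k) q (m - k) * (g l * qPoch (X * q ^ l) q (n - l)) *
        qPoch X q (l + k) =
      ∑ j ∈ range (m + 1), qPoch X q m * qPoch X q n *
        (qPoch q q j * X ^ j / qPoch X q j) *
          ((q ^ (j.choose 2) * (f k * qBinom q k j)) *
            (q ^ (j.choose 2) * (g l * qBinom q l j))) := by
    intro k hk l hl
    have hk : k ≤ m := by simpa [Nat.lt_succ_iff] using hk
    have hl : l ≤ n := by simpa [Nat.lt_succ_iff] using hl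
    rw [← qPoch_mul_qPoch_sub X q hk, ← qPoch_mul_qPoch_sub X q hl, qPoch_add X,
      qPoch_add_eq_sum (q := q) (x := X) k l]
    have hsub : range (k + 1) ⊆ range (m + 1) := range_subset_range.2 (by omega)
    rw [sum_subset hsub, mul_sum, mul_sum]
    · refine sum_congr rfl fun j _ => ?_
      rcases Nat.lt_or_ge k j with hj | hj
      · rw [qBinom_eq_zero q hj]; ring
      · have h1 := qPoch_mul_qPoch_sub X q hj
        have h2 := mul_inv_cancel₀ (hX j)
        rw [two_mul, pow_add, ← h1, div_eq_mul_inv]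
        linear_combination (-(f k * qPoch (X * q ^ k) q (m - k) * g l *
          qPoch (X * q ^ l) q (n - l) * qPoch X q l * qPoch (X * q ^ j) q (k - j) *
          qBinom q k j * qBinom q l j * qPoch q q j * X ^ j * (q ^ (j.choose 2)) ^ 2)) * h2
    · intro j _ hj
      rw [qBinom_eq_zero q (by simpa using hj), zero_mul]
  rw [sum_congr rfl fun k hk => sum_congr rfl (hterm k hk)]
  have hswap : ∀ k ∈ range (m + 1), (∑ l ∈ range (n + 1), ∑ j ∈ range (m + 1),
      qPoch X q m * qPoch X q n * (qPoch q q j * X ^ j / qPoch X q j) *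
          ((q ^ (j.choose 2) * (f k * qBinom q k j)) *
            (q ^ (j.choose 2) * (g l * qBinom q l j)))) =
      ∑ j ∈ range (m + 1), qPoch X q m * qPoch X q n * (qPoch q q j * X ^ j / qPoch X q j) *
          (q ^ (j.choose 2) * (f k * qBinom q k j)) *
            (q ^ (j.choose 2) * ∑ l ∈ range (n + 1), g l * qBinom q l j) := by
    intro k _
    rw [sum_comm]
    refine sum_congr rfl fun j _ => ?_
    rw [mul_sum, mul_sum]
    exact sum_congr rfl fun l _ => by ring
  rw [sum_congr rfl hswap, sum_comm, mul_sum]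
  -- the sums over `k` and `l` are now separated
  refine sum_congr rfl fun j _ => ?_
  rw [← sum_mul, ← mul_sum, ← mul_sum, hf, hg, sum_qBinom_mul_qBinom_chu hm,
    sum_qBinom_mul_qBinom_chu hn]
  have : ((-1 : ℂ) ^ j) ^ 2 = 1 := by rw [← pow_mul, mul_comm, pow_mul]; simp
  linear_combination (qPoch X q m * qPoch X q n * (qPoch q q j * X ^ j / qPoch X q j) *
    qBinom q m j * qBinom q n j * qPoch A q j * qPoch B q j * q ^ (m.choose 2) *
    q ^ (n.choose 2) * (∏ i ∈ range (m - j), (A - x * q ^ i)) *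
      ∏ i ∈ range (n - j), (B - y * q ^ i)) * this

lemma prod_sub_mul_pow {A : ℂ} (hA : A ≠ 0) (x q : ℂ) (r : ℕ) :
    ∏ i ∈ range r, (A - x * q ^ i) = A ^ r * qPoch (x / A) q r := by
  rw [qPoch, ← card_range r, ← prod_const, card_range, ← prod_mul_distrib]
  exact prod_congr rfl fun i _ => by field_simp

/-- `genMean_eval` at `b₁ = bq^k`, `b₂ = bq^l`, with the factors common to all `k ≤ m`, `l ≤ n`
pulled out, so that nothing is divided by a possibly vanishing `(b/c; q)_k` or `(qcb; q)_l`. -/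
lemma genMean_mul_pow {b c q : ℂ} (hq : ‖q‖ < 1) (hq0 : q ≠ 0) (hc : c ≠ 0) (hb : ‖b‖ < 1)
    {k l m n : ℕ} (hk : k ≤ m) (hl : l ≤ n) :
    qPochInf q q * qPochInf (b ^ 2) q * genMean (b * q ^ k) (b * q ^ l) c q =
      qPochInf (b / c * q ^ m) q * qPochInf (q * c * b * q ^ n) q *
        (qPoch (b / c * q ^ k) q (m - k) * qPoch (q * c * b * q ^ l) q (n - l) *
          qPoch (b ^ 2) q (l + k)) := by
  have h := genMean_eval hq hq0 hc (norm_mul_pow_lt_one hq hb k) (norm_mul_pow_lt_one hq hb l)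
  have h1 := qPoch_mul_qPochInf hq (b ^ 2) (l + k)
  have h2 := qPoch_mul_qPochInf hq (b / c * q ^ k) (m - k)
  have h3 := qPoch_mul_qPochInf hq (q * c * b * q ^ l) (n - l)
  rw [mul_assoc, ← pow_add, Nat.add_sub_cancel' hk] at h2
  rw [mul_assoc (q * c * b), ← pow_add, Nat.add_sub_cancel' hl] at h3
  rw [show b * q ^ k * (b * q ^ l) = b ^ 2 * q ^ (l + k) by ring,
    show b * q ^ k / c = b / c * q ^ k by ring,
    show q * c * (b * q ^ l) = q * c * b * q ^ l by ring, ← h2, ← h3] at h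
  rw [← h1]
  linear_combination qPoch (b ^ 2) q (l + k) * h

lemma continuousOn_mul_genWeight {b₁ b₂ c q : ℂ} (hq : ‖q‖ < 1) (hc : c ≠ 0)
    (h₁ : ‖b₁‖ < 1) (h₂ : ‖b₂‖ < 1) {f : ℂ → ℂ} (hf : ContinuousOn f (Metric.sphere 0 1)) :
    ContinuousOn (fun z => f z * genWeight b₁ b₂ c q z) (Metric.sphere 0 1) :=
  hf.mul (continuousOn_genWeight hq hc h₁ h₂)

/-- Mean of `R_m(b/a, ab; az) R_n(ab, b/a; 1/(az))`: the first factor is expanded in the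
`(bz; q)_k`, the second in the `(b/z; q)_l`. -/
lemma circleMean_rogersSum_mul_inv {a b c q : ℂ} (hq : ‖q‖ < 1) (hq0 : q ≠ 0) (ha : a ≠ 0)
    (hb0 : b ≠ 0) (hc : c ≠ 0) (hb : ‖b‖ < 1) (m n : ℕ) :
    qPochInf q q * qPochInf (b ^ 2) q * circleMean (fun z =>
      rogersSum q (b / a) (a * b) m (a * z) * rogersSum q (a * b) (b / a) n (a * z)⁻¹ *
        genWeight b b c q z) =
    qPochInf (b / c * q ^ m) q * qPochInf (q * c * b * q ^ n) q *
      (qPoch (b ^ 2) q m * qPoch (b ^ 2) q n *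
        ∑ j ∈ range (m + 1), qBinom q m j * qBinom q n j *
          (qPoch q q j * qPoch (b / a) q j * qPoch (a * b) q j / qPoch (b ^ 2) q j *
            (qPoch (a / c) q (m - j) * qPoch (q * c / a) q (n - j)))) := by
  have hqm := qPoch_ne_zero_of_norm_lt hq hq m
  have hqn := qPoch_ne_zero_of_norm_lt hq hq n
  have hb2 : ‖b ^ 2‖ < 1 := by
    rw [norm_pow]; exact pow_lt_one₀ (norm_nonneg _) hb two_ne_zero
  have hX : ∀ k, qPoch (b ^ 2) q k ≠ 0 := qPoch_ne_zero_of_norm_lt hq hb2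
  have hA : b / a ≠ 0 := div_ne_zero hb0 ha
  have hB : a * b ≠ 0 := mul_ne_zero ha hb0
  have hAB : b / a * (a * b) = b ^ 2 := by field_simp
  have hN : q ^ (m.choose 2) * (b / a) ^ m * (q ^ (n.choose 2) * (a * b) ^ n) ≠ 0 := by
    simp only [ne_eq, mul_eq_zero, pow_eq_zero_iff', hq0, hA, hB, false_and, or_self,
      not_false_eq_true]
  apply mul_left_cancel₀ hN
  have hint : q ^ (m.choose 2) * (b / a) ^ m * (q ^ (n.choose 2) * (a * b) ^ n) *
      circleMean (fun z =>
        rogersSum q (b / a) (a * b) m (a * z) * rogersSum q (a * b) (b / a) n (a * z)⁻¹ *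
        genWeight b b c q z) =
      ∑ k ∈ range (m + 1), ∑ l ∈ range (n + 1),
        (qBinom q m k * ((-1) ^ k * q ^ ((m - k).choose 2) * qPoch (b / a) q k *
          qPoch (b ^ 2 * q ^ k) q (m - k))) *
        (qBinom q n l * ((-1) ^ l * q ^ ((n - l).choose 2) * qPoch (a * b) q l *
          qPoch (b ^ 2 * q ^ l) q (n - l))) * genMean (b * q ^ k) (b * q ^ l) c q := by
    rw [← circleMean_const_mul]
    have hc1 : ∀ k l : ℕ, ContinuousOn (fun z =>
        (qBinom q m k * ((-1) ^ k * q ^ ((m - k).choose 2) * qPoch (b / a) q k *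
          qPoch (b ^ 2 * q ^ k) q (m - k))) *
        (qBinom q n l * ((-1) ^ l * q ^ ((n - l).choose 2) * qPoch (a * b) q l *
          qPoch (b ^ 2 * q ^ l) q (n - l))) * genWeight (b * q ^ k) (b * q ^ l) c q z)
          (Metric.sphere 0 1) := fun k l =>
      continuousOn_mul_genWeight hq hc (norm_mul_pow_lt_one hq hb k)
        (norm_mul_pow_lt_one hq hb l) continuousOn_const
    simp only [genMean, ← circleMean_const_mul]
    rw [sum_congr rfl fun k _ => (circleMean_sum (range (n + 1)) fun l _ => hc1 k l).symm,
      ← circleMean_sum]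
    · refine circleMean_congr fun z hz => ?_
      have hz0 := ne_zero_of_norm_one hz
      have e1 := rogersSum_expand hqm (b / a) (a * b) (a * z)
      have e2 := rogersSum_expand hqn (a * b) (b / a) (a * z)⁻¹
      rw [hAB, show b / a * (a * z) = b * z by field_simp] at e1
      rw [mul_comm (a * b) (b / a), hAB, show a * b * (a * z)⁻¹ = b / z by field_simp] at e2
      have e3 : ∀ k l : ℕ, genWeight (b * q ^ k) (b * q ^ l) c q z =
          qPoch (b * z) q k * qPoch (b / z) q l * genWeight b b c q z := by
        intro k l
        rw [genWeight_mul_pow_left c hq (by rwa [norm_mul, hz, mul_one]),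
          genWeight_mul_pow_right c hq (by rwa [norm_div, hz, div_one])]
        ring
      simp only [e3]
      calc _ = (q ^ (m.choose 2) * (b / a) ^ m * rogersSum q (b / a) (a * b) m (a * z)) *
            (q ^ (n.choose 2) * (a * b) ^ n * rogersSum q (a * b) (b / a) n (a * z)⁻¹) *
              genWeight b b c q z := by ring
        _ = _ := by
          rw [e1, e2, sum_mul_sum, sum_mul]
          refine sum_congr rfl fun k _ => ?_
          rw [sum_mul]
          exact sum_congr rfl fun l _ => by ring
    · exact fun k _ => continuousOn_finsetSum _ fun l _ => hc1 k l
  rw [mul_left_comm, hint, mul_sum]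
  have hsum := double_sum_eval hqm hqn hX (b / a) (a * b) (b / c) (q * c * b)
  calc _ = qPochInf (b / c * q ^ m) q * qPochInf (q * c * b * q ^ n) q *
      ∑ k ∈ range (m + 1), ∑ l ∈ range (n + 1),
      (qBinom q m k * ((-1) ^ k * q ^ ((m - k).choose 2) * qPoch (b / a) q k *
        qPoch (b / c * q ^ k) q (m - k)) * qPoch (b ^ 2 * q ^ k) q (m - k)) *
      (qBinom q n l * ((-1) ^ l * q ^ ((n - l).choose 2) * qPoch (a * b) q l *
        qPoch (q * c * b * q ^ l) q (n - l)) * qPoch (b ^ 2 * q ^ l) q (n - l)) *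
          qPoch (b ^ 2) q (l + k) := by
        rw [mul_sum]
        refine sum_congr rfl fun k hk => ?_
        rw [mul_sum, mul_sum]
        refine sum_congr rfl fun l hl => ?_
        have hk : k ≤ m := by simpa [Nat.lt_succ_iff] using hk
        have hl : l ≤ n := by simpa [Nat.lt_succ_iff] using hl
        rw [mul_left_comm, genMean_mul_pow hq hq0 hc hb hk hl]
        ring
    _ = _ := by
        rw [hsum, mul_sum, mul_sum, mul_sum, mul_sum, mul_sum]
        refine sum_congr rfl fun j hj => ?_
        have hj : j ≤ m := by simpa [Nat.lt_succ_iff] using hj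
        rcases Nat.lt_or_ge n j with hn | hn
        · rw [qBinom_eq_zero q hn]; ring
        rw [prod_sub_mul_pow hA, prod_sub_mul_pow hB, show b / c / (b / a) = a / c by field_simp,
          show q * c * b / (a * b) = q * c / a by field_simp, ← hAB, mul_pow]
        obtain ⟨d, rfl⟩ := Nat.exists_eq_add_of_le hj
        obtain ⟨e, rfl⟩ := Nat.exists_eq_add_of_le hn
        rw [Nat.add_sub_cancel_left, Nat.add_sub_cancel_left]
        ring

lemma two_mul_choose_two_add (n : ℕ) : 2 * n.choose 2 + n = n * n := by
  induction n with
  | zero => rfl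
  | succ n ih => rw [choose_two_succ]; linarith

lemma qBinom_eq_zero_or_le (q : ℂ) (n j : ℕ) : qBinom q n j = 0 ∨ j ≤ n :=
  (Nat.lt_or_ge n j).imp_left (qBinom_eq_zero q)

/-- Mean of `R_m(b/a, ab; az) R_n(b/a, ab; az)`. Apart from `(b²; q)_j`, which does not vanish, no
division occurs, so every `c ≠ 0` is allowed. -/
lemma circleMean_rogersSum_mul {a b c q : ℂ} (hq : ‖q‖ < 1) (hq0 : q ≠ 0) (ha : a ≠ 0)
    (hb0 : b ≠ 0) (hc : c ≠ 0) (hb : ‖b‖ < 1) (m n : ℕ) :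
    qPochInf q q * qPochInf (b ^ 2) q * circleMean (fun z =>
      rogersSum q (b / a) (a * b) m (a * z) * rogersSum q (b / a) (a * b) n (a * z) *
        genWeight b b c q z) =
    qPochInf (b / c * q ^ (m + n)) q * qPochInf (q * c * b) q *
      (qPoch (b ^ 2) q m * qPoch (b ^ 2) q n *
        ∑ j ∈ range (m + 1), qBinom q m j * qBinom q n j *
          (qPoch q q j * qPoch (b / a) q j * qPoch (a * b) q j / qPoch (b ^ 2) q j *
            ((-(a / c)) ^ j * q ^ (j.choose 2) * qPoch (a / c * q ^ j) q (m + n - 2 * j)))) := by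
  have hqn := qPoch_ne_zero_of_norm_lt hq hq n
  have hpn := pow_ne_zero n hq0
  have hτ : a / c ≠ 0 := div_ne_zero ha hc
  -- the parameter for which `z ^ n` is absorbed by the weight
  set d := c / q ^ n with hd
  have hd0 : d ≠ 0 := div_ne_zero hc hpn
  have hdq : d * q ^ n = c := div_mul_cancel₀ c hpn
  have hF := circleMean_rogersSum_mul_inv hq hq0 ha hb0 hd0 hb m n
  have hint : circleMean (fun z =>
      rogersSum q (b / a) (a * b) m (a * z) * rogersSum q (a * b) (b / a) n (a * z)⁻¹ *
        genWeight b b d q z) = (-d) ^ n * q ^ ((n + 1).choose 2) * (a ^ n)⁻¹ *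
      circleMean (fun z =>
        rogersSum q (b / a) (a * b) m (a * z) * rogersSum q (b / a) (a * b) n (a * z) *
          genWeight b b c q z) := by
    rw [← circleMean_const_mul]
    refine circleMean_congr fun z hz => ?_
    have hz0 := ne_zero_of_norm_one hz
    rw [rogersSum_reverse hqn (b / a) (a * b) (mul_ne_zero ha hz0),
      genWeight_mul_pow_c b b hq hq0 hd0 hz0 n, hdq, mul_pow]
    have := pow_ne_zero n ha
    field_simp
  -- the constants from `z ^ n` and from reversing `(qd/a; q)_{n-j}` cancel
  have hκ : (-(a / c)) ^ n * q ^ (n.choose 2) *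
      ((-d) ^ n * q ^ ((n + 1).choose 2) * (a ^ n)⁻¹) = 1 := by
    have e : n.choose 2 + (n + 1).choose 2 = n * n := by
      rw [choose_two_succ]; linarith [two_mul_choose_two_add n]
    have e2 : q ^ (n.choose 2) * q ^ ((n + 1).choose 2) = (q ^ n) ^ n := by
      rw [← pow_add, e, pow_mul]
    calc _ = ((-(a / c)) * (-d) * a⁻¹) ^ n * (q ^ (n.choose 2) * q ^ ((n + 1).choose 2)) := by
          rw [mul_pow, mul_pow, inv_pow]; ring
      _ = ((-(a / c)) * (-d) * a⁻¹ * q ^ n) ^ n := by rw [e2, mul_pow _ (q ^ n)]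
      _ = 1 := by
        rw [show (-(a / c)) * (-d) * a⁻¹ * q ^ n = a / c * a⁻¹ * (d * q ^ n) by ring, hdq]
        rw [show a / c * a⁻¹ * c = 1 by field_simp, one_pow]
  rw [hint] at hF
  have hx : b / d * q ^ m = b / c * q ^ (m + n) := by rw [hd, pow_add]; field_simp
  have hy : q * d * b * q ^ n = q * c * b := by rw [← hdq]; ring
  rw [hx, hy] at hF
  set CM := circleMean (fun z =>
        rogersSum q (b / a) (a * b) m (a * z) * rogersSum q (b / a) (a * b) n (a * z) *
          genWeight b b c q z)
  have hsum : (-(a / c)) ^ n * q ^ (n.choose 2) *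
      ∑ j ∈ range (m + 1), qBinom q m j * qBinom q n j *
          (qPoch q q j * qPoch (b / a) q j * qPoch (a * b) q j / qPoch (b ^ 2) q j *
            (qPoch (a / d) q (m - j) * qPoch (q * d / a) q (n - j))) =
      ∑ j ∈ range (m + 1), qBinom q m j * qBinom q n j *
          (qPoch q q j * qPoch (b / a) q j * qPoch (a * b) q j / qPoch (b ^ 2) q j *
            ((-(a / c)) ^ j * q ^ (j.choose 2) * qPoch (a / c * q ^ j) q (m + n - 2 * j))) := by
    rw [mul_sum]
    refine sum_congr rfl fun j hj => ?_
    rcases qBinom_eq_zero_or_le q n j with h0 | hjn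
    · rw [h0]; ring
    have hjm : j ≤ m := by simpa [Nat.lt_succ_iff] using hj
    have hrev := qPoch_reverse hτ hq0 n (n - j) (Nat.sub_le n j)
    rw [Nat.sub_sub_self hjn, show q / (a / c * q ^ n) = q * d / a by rw [hd]; field_simp] at hrev
    have hadd := qPoch_add (a / c * q ^ j) q (n - j) (m - j)
    rw [show n - j + (m - j) = m + n - 2 * j by omega, mul_assoc (a / c), ← pow_add,
      Nat.add_sub_cancel' hjn, show a / c * q ^ n = a / d by rw [hd]; field_simp] at hadd
    have hp : (-(a / c)) ^ n = (-(a / c)) ^ j * (-(a / c)) ^ (n - j) := by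
      rw [← pow_add, Nat.add_sub_cancel' hjn]
    rw [hadd, hp]
    linear_combination (qBinom q m j * qBinom q n j *
          (qPoch q q j * qPoch (b / a) q j * qPoch (a * b) q j / qPoch (b ^ 2) q j *
            qPoch (a / d) q (m - j)) * (-(a / c)) ^ j) * hrev
  rw [← hsum]
  linear_combination (-(a / c)) ^ n * q ^ (n.choose 2) * hF -
    qPochInf q q * qPochInf (b ^ 2) q * CM * hκ

/-! ### The Laurent polynomials `P_n` -/

/-- `(q^{-n}; q)_k` in terms of `[n, k]`. -/
lemma qPoch_neg_pow {q : ℂ} {n : ℕ} (hq0 : q ≠ 0) (k : ℕ) :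
    q ^ (k.choose 2) * qBinom q n k * qPoch q q k * (-1) ^ k =
      q ^ (n * k) * qPoch (q ^ (-(n : ℤ))) q k := by
  have h := prod_pow_sub_pow q n k
  have e : ∏ i ∈ range k, (q ^ i - q ^ n) = (-1) ^ k * (q ^ (n * k) *
      qPoch (q ^ (-(n : ℤ))) q k) := by
    rw [pow_mul, qPoch]
    conv_rhs => rw [← card_range k, ← prod_const, ← prod_const, card_range]
    rw [← prod_mul_distrib, ← prod_mul_distrib]
    refine prod_congr rfl fun i _ => ?_
    have := pow_ne_zero n hq0
    rw [zpow_neg, zpow_natCast]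
    field_simp
    ring
  rw [e] at h
  have h2 : ((-1 : ℂ) ^ k) ^ 2 = 1 := by rw [← pow_mul, mul_comm, pow_mul]; simp
  linear_combination (-(-1) ^ k) * h + q ^ (n * k) * qPoch (q ^ (-(n : ℤ))) q k * h2

lemma qPoch_neg_pow_eq_zero {q : ℂ} (hq0 : q ≠ 0) {n k : ℕ} (h : n < k) :
    qPoch (q ^ (-(n : ℤ))) q k = 0 := by
  refine qPoch_eq_zero h ?_
  rw [zpow_neg, zpow_natCast, inv_mul_cancel₀ (pow_ne_zero n hq0)]

/-- `P_n` in terms of `R_n`. -/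
lemma lauP_eq {a b q : ℂ} (ha : a ≠ 0) (hb : b ≠ 0) (hq0 : q ≠ 0) {n : ℕ}
    (hqn : qPoch q q n ≠ 0) (hab : qPoch (a * b) q n ≠ 0) (z : ℂ) :
    lauP a b q n z = z ^ (-((n / 2 : ℕ) : ℤ)) *
      (rogersSum q (b / a) (a * b) n (a * z) / qPoch (a * b) q n) := by
  rw [lauP]
  congr 1
  -- the terms with `k > n` vanish, as `(q^{-n}; q)_k = 0`, whatever their denominators are
  rw [basicHyp, tsum_eq_sum (s := range (n + 1)), rogersSum, sum_div]
  · refine sum_congr rfl fun k hk => ?_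
    have hk : k ≤ n := by simpa [Nat.lt_succ_iff] using hk
    simp only [List.map_cons, List.map_nil, List.prod_cons, List.prod_nil, mul_one]
    have hqk : qPoch q q k ≠ 0 := qPoch_ne_zero_of_le hk hqn
    have hB : a * b ≠ 0 := mul_ne_zero ha hb
    have h1 := qPoch_neg_pow (n := n) hq0 k
    have h2 := qPoch_reverse hB hq0 n k hk
    have h3 := qPoch_mul_qPoch_sub (a * b) q (Nat.sub_le n k)
    rw [Nat.sub_sub_self hk] at h3
    have hqp : q / (a * b * q ^ n) = q ^ (1 - (n : ℤ)) / (a * b) := by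
      rw [zpow_sub₀ hq0, zpow_one, zpow_natCast]
      field_simp
    rw [hqp] at h2
    have h4 : qPoch (a * b * q ^ (n - k)) q k ≠ 0 := fun h => hab (by rw [← h3, h, mul_zero])
    have hD : qPoch (q ^ (1 - (n : ℤ)) / (a * b)) q k ≠ 0 := by
      intro h
      rw [h, mul_zero] at h2
      exact mul_ne_zero (pow_ne_zero _ hq0) h4 h2.symm
    have hBn : qPoch (a * b) q (n - k) ≠ 0 := qPoch_ne_zero_of_le (Nat.sub_le n k) hab
    rw [← h3, div_mul_eq_mul_div, div_eq_div_iff (mul_ne_zero hqk hD) (mul_ne_zero hBn h4)]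
    have hch : q ^ (k.choose 2) * q ^ (n.choose 2) * q ^ k =
        q ^ (n * k) * q ^ ((n - k).choose 2) := by
      obtain ⟨d, rfl⟩ := Nat.exists_eq_add_of_le hk
      rw [← pow_add, ← pow_add, ← pow_add, choose_two_add, Nat.add_sub_cancel_left]
      congr 1
      linarith [two_mul_choose_two_add k]
    have hN : q ^ (n * k) * b ^ k * q ^ ((n - k).choose 2) ≠ 0 :=
      mul_ne_zero (mul_ne_zero (pow_ne_zero _ hq0) (pow_ne_zero _ hb)) (pow_ne_zero _ hq0)
    apply mul_left_cancel₀ hN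
    have hz : (q * z / b) ^ k * b ^ k = q ^ k * z ^ k := by
      rw [← mul_pow, div_mul_cancel₀ _ hb, mul_pow]
    have hs : (-1 : ℂ) ^ k * (-(a * b)) ^ k = a ^ k * b ^ k := by
      rw [← mul_pow, ← mul_pow]; ring
    rw [mul_pow a z]
    set S := qPoch (q ^ (-(n : ℤ))) q k
    set D := qPoch (q ^ (1 - (n : ℤ)) / (a * b)) q k
    set W := qPoch (a * b * q ^ (n - k)) q k
    set A := qPoch (b / a) q k
    set B := qPoch (a * b) q (n - k)
    set G := qBinom q n k * qPoch q q k
    have hG : q ^ (k.choose 2) * G * (-1) ^ k = q ^ (n * k) * S := by rw [← h1]; ring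
    calc _ = (q ^ (n * k) * S) * (q ^ ((n - k).choose 2) * W) *
          ((q * z / b) ^ k * b ^ k) * A * B := by ring
      _ = (q ^ (k.choose 2) * q ^ (n.choose 2) * q ^ k) * ((-1) ^ k * (-(a * b)) ^ k) * G * D *
          z ^ k * A * B := by rw [← hG, ← h2, hz]; ring
      _ = q ^ (n * k) * b ^ k * q ^ ((n - k).choose 2) * (A * B * a ^ k * z ^ k * (G * D)) := by
          rw [hch, hs]; ring
      _ = _ := by ring
  · intro k hk
    simp only [List.map_cons, List.prod_cons]
    rw [qPoch_neg_pow_eq_zero hq0 (by simpa using hk)]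
    simp

lemma polyP_eq {a b q : ℂ} (ha : a ≠ 0) (hb : b ≠ 0) (hq0 : q ≠ 0) {n : ℕ}
    (hqn : qPoch q q n ≠ 0) (hab : qPoch (a * b) q n ≠ 0) {z : ℂ} (hz : z ≠ 0) :
    polyP a b q n z = rogersSum q (b / a) (a * b) n (a * z) / qPoch (a * b) q n := by
  rw [polyP, lauP_eq ha hb hq0 hqn hab, ← mul_assoc, zpow_neg, zpow_natCast,
    mul_inv_cancel₀ (pow_ne_zero _ hz), one_mul]

lemma lauP_eq_zpow_mul_polyP (a b q : ℂ) (n : ℕ) {z : ℂ} (hz : z ≠ 0) :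
    lauP a b q n z = z ^ (-((n / 2 : ℕ) : ℤ)) * polyP a b q n z := by
  rw [polyP, ← mul_assoc, zpow_neg, zpow_natCast, inv_mul_cancel₀ (pow_ne_zero _ hz), one_mul]

/-- The exponents of the first `n + 1` terms of `1, z, z⁻¹, z², …` are consecutive integers. -/
lemma sum_lauExp (n : ℕ) (F : ℤ → ℂ) :
    ∑ k ∈ range (n + 1), F (lauExp k) = ∑ i ∈ range (n + 1), F (i - (n / 2 : ℕ)) := by
  refine sum_bij' (fun k _ => (lauExp k + (n / 2 : ℕ)).toNat)
    (fun i _ => if i ≤ n / 2 then 2 * (n / 2 - i) else 2 * (i - n / 2) - 1) ?_ ?_ ?_ ?_ ?_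
  · intro k hk
    simp only [mem_range, lauExp, Nat.even_iff] at *
    split_ifs <;> omega
  · intro i hi
    simp only [mem_range] at *
    split_ifs <;> omega
  · intro k hk
    simp only [mem_range, lauExp, Nat.even_iff] at *
    split_ifs <;> omega
  · intro i hi
    simp only [mem_range, lauExp, Nat.even_iff] at *
    split_ifs <;> omega
  · intro k hk
    congr 1
    simp only [mem_range, lauExp, Nat.even_iff] at *
    split_ifs <;> omega

lemma leadC_ne_zero {a b q : ℂ} (ha : a ≠ 0) {n : ℕ} (hab : qPoch (a * b) q n ≠ 0)
    (hA : Odd n → qPoch (b / a) q n ≠ 0) : leadC a b q n ≠ 0 := by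
  rw [leadC]
  split_ifs with h
  · exact one_ne_zero
  · exact div_ne_zero (mul_ne_zero (pow_ne_zero n ha) (hA (Nat.not_even_iff_odd.1 h))) hab

/-- The coefficient of `z^i` in `p_n` is `[n, i] (b/a; q)_i (ab; q)_{n-i} a^i / (ab; q)_n`. The last
term of `P_n` has exponent `-n/2` (`i = 0`) for even `n` and `(n+1)/2` (`i = n`) for odd `n`. -/
lemma isMonicLaurent_lauP {a b q : ℂ} (ha : a ≠ 0) (hb : b ≠ 0) (hq0 : q ≠ 0) {n : ℕ}
    (hqn : qPoch q q n ≠ 0) (hab : qPoch (a * b) q n ≠ 0)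
    (hA : Odd n → qPoch (b / a) q n ≠ 0) :
    IsMonicLaurent (fun z => lauP a b q n z / leadC a b q n) n := by
  set g : ℕ → ℂ := fun i => qBinom q n i * (qPoch (b / a) q i * qPoch (a * b) q (n - i) * a ^ i) /
    qPoch (a * b) q n / leadC a b q n with hg
  refine ⟨fun k => g (lauExp k + (n / 2 : ℕ)).toNat, ?_, fun z hz => ?_⟩
  · have hC := leadC_ne_zero ha hab hA
    by_cases hn : Even n
    · have e : (lauExp n + (n / 2 : ℕ)).toNat = 0 := by simp [lauExp, hn]
      simp only [e, hg, leadC, hn]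
      simp [hab]
    · have e : (lauExp n + (n / 2 : ℕ)).toNat = n := by
        simp only [lauExp, hn, if_false]
        rw [Nat.even_iff] at hn
        omega
      simp only [e, hg]
      rw [qBinom_self, Nat.sub_self, qPoch_zero, one_mul, mul_one, div_eq_one_iff_eq hC, leadC,
        if_neg hn, mul_comm]
  · beta_reduce
    rw [sum_lauExp n (fun e => g (e + (n / 2 : ℕ)).toNat * z ^ e),
      lauP_eq ha hb hq0 hqn hab z, rogersSum, sum_div, mul_sum, sum_div]
    refine sum_congr rfl fun i _ => ?_
    rw [sub_add_cancel, Int.toNat_natCast, zpow_sub₀ hz, zpow_neg, zpow_natCast, zpow_natCast,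
      mul_pow, hg]
    ring

/-! ### Values of the functional -/

/-- The factor `z^{-M}` of `P_m P_n` is absorbed by the weight, which becomes that of `c q^M`. The
normalization then leaves `(qbc; q)_M (b/c; q)_N` in the denominator. -/
lemma mu_lauP_mul_lauP {a b c q : ℂ} (hq : ‖q‖ < 1) (hq0 : q ≠ 0) (ha : a ≠ 0)
    (hb0 : b ≠ 0) (hc : c ≠ 0) (hb : ‖b‖ < 1) (hab : ∀ k : ℕ, a * b * q ^ k ≠ 1)
    (h1 : ∀ k : ℕ, q * b * c * q ^ k ≠ 1) (h2 : ∀ k : ℕ, b / c * q ^ k ≠ 1)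
    {m n M N : ℕ} (hM : M = m / 2 + n / 2) (hN : N = (m + 1) / 2 + (n + 1) / 2) :
    mu c b q (fun z => lauP a b q m z * lauP a b q n z) =
      (-c) ^ M * q ^ ((M + 1).choose 2) *
        ((qPoch (b ^ 2) q m * qPoch (b ^ 2) q n) / (qPoch (a * b) q m * qPoch (a * b) q n *
          qPoch (q * b * c) q M * qPoch (b / c) q N)) *
        ∑ j ∈ range (m + 1), qBinom q m j * qBinom q n j *
          (qPoch q q j * qPoch (b / a) q j * qPoch (a * b) q j / qPoch (b ^ 2) q j *
            ((-(a / (c * q ^ M))) ^ j * q ^ (j.choose 2) *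
              qPoch (a / (c * q ^ M) * q ^ j) q (m + n - 2 * j))) := by
  have hqp : ∀ k, qPoch q q k ≠ 0 := qPoch_ne_zero_of_norm_lt hq hq
  have habp : ∀ k, qPoch (a * b) q k ≠ 0 := fun k => qPoch_ne_zero_iff.2 fun i _ => hab i
  have hpM := pow_ne_zero M hq0
  have hcM : c * q ^ M ≠ 0 := mul_ne_zero hc hpM
  have hG := circleMean_rogersSum_mul hq hq0 ha hb0 hcM hb m n
  have hint : circleMean (fun z => lauP a b q m z * lauP a b q n z * weight c b q z) =
      (-c) ^ M * q ^ ((M + 1).choose 2) / (qPoch (a * b) q m * qPoch (a * b) q n) *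
      circleMean (fun z => rogersSum q (b / a) (a * b) m (a * z) *
        rogersSum q (b / a) (a * b) n (a * z) * genWeight b b (c * q ^ M) q z) := by
    rw [← circleMean_const_mul]
    refine circleMean_congr fun z hz => ?_
    have hz0 := ne_zero_of_norm_one hz
    rw [lauP_eq ha hb0 hq0 (hqp m) (habp m), lauP_eq ha hb0 hq0 (hqp n) (habp n),
      weight_eq_genWeight, genWeight_mul_pow_c b b hq hq0 hc hz0 M]
    have e : z ^ (-((m / 2 : ℕ) : ℤ)) * z ^ (-((n / 2 : ℕ) : ℤ)) * z ^ M = 1 := by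
      rw [← zpow_add₀ hz0, ← zpow_natCast z M, ← zpow_add₀ hz0, hM]
      push_cast
      rw [show (-((m : ℤ) / 2) + -((n : ℤ) / 2) + ((m : ℤ) / 2 + (n : ℤ) / 2)) = 0 by ring,
        zpow_zero]
    linear_combination ((-c) ^ M * q ^ ((M + 1).choose 2) *
      (rogersSum q (b / a) (a * b) m (a * z) / qPoch (a * b) q m) *
      (rogersSum q (b / a) (a * b) n (a * z) / qPoch (a * b) q n) *
      genWeight b b (c * q ^ M) q z) * e
  have hk1 := qPoch_mul_qPochInf hq (q * b * c) M
  have hk2 := qPoch_mul_qPochInf hq (b / c) N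
  have hn1 : qPochInf (q * b * c) q ≠ 0 := qPochInf_ne_zero hq h1
  have hn2 : qPochInf (b / c) q ≠ 0 := qPochInf_ne_zero hq h2
  rw [← hk1] at hn1
  rw [← hk2] at hn2
  have e1 : b / (c * q ^ M) * q ^ (m + n) = b / c * q ^ N := by
    rw [show m + n = M + N by omega, pow_add]; field_simp
  have e2 : q * (c * q ^ M) * b = q * b * c * q ^ M := by ring
  rw [e1, e2] at hG
  rw [mu, hint, show q * c * b = q * b * c by ring, ← hk1, ← hk2]
  set S := ∑ j ∈ range (m + 1), qBinom q m j * qBinom q n j *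
          (qPoch q q j * qPoch (b / a) q j * qPoch (a * b) q j / qPoch (b ^ 2) q j *
            ((-(a / (c * q ^ M))) ^ j * q ^ (j.choose 2) *
              qPoch (a / (c * q ^ M) * q ^ j) q (m + n - 2 * j)))
  set CM := circleMean (fun z => rogersSum q (b / a) (a * b) m (a * z) *
        rogersSum q (b / a) (a * b) n (a * z) * genWeight b b (c * q ^ M) q z)
  have hm0 := habp m
  have hn0 := habp n
  have n1 := left_ne_zero_of_mul hn1
  have n2 := right_ne_zero_of_mul hn1
  have n3 := left_ne_zero_of_mul hn2
  have n4 := right_ne_zero_of_mul hn2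
  rw [div_mul_eq_mul_div, div_eq_iff (mul_ne_zero hn1 hn2)]
  calc _ = (-c) ^ M * q ^ ((M + 1).choose 2) / (qPoch (a * b) q m * qPoch (a * b) q n) *
        (qPochInf q q * qPochInf (b ^ 2) q * CM) := by ring
    _ = _ := by
      rw [hG]
      generalize qPoch (a * b) q m = u1 at *
      generalize qPoch (a * b) q n = u2 at *
      generalize qPoch (q * b * c) q M = u3 at *
      generalize qPoch (b / c) q N = u4 at *
      field_simp

/-- Only the term `j = m = n` survives when the functional belongs to the same parameter as the
polynomials. -/
lemma mu_lauP_mul_lauP_self {a b q : ℂ} (hq : ‖q‖ < 1) (hq0 : q ≠ 0) (ha : a ≠ 0)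
    (hb0 : b ≠ 0) (hb : ‖b‖ < 1) (hab : ∀ k : ℕ, a * b * q ^ k ≠ 1)
    (hba : ∀ k : ℕ, b / a * q ^ k ≠ 1) (m n : ℕ) :
    mu a b q (fun z => lauP a b q m z * lauP a b q n z) = if m = n then normH a b q n else 0 := by
  have hb2 : ‖b ^ 2‖ < 1 := by
    rw [norm_pow]; exact pow_lt_one₀ (norm_nonneg _) hb two_ne_zero
  have hX : ∀ k, qPoch (b ^ 2) q k ≠ 0 := qPoch_ne_zero_of_norm_lt hq hb2
  have habp : ∀ k, qPoch (a * b) q k ≠ 0 := fun k => qPoch_ne_zero_iff.2 fun i _ => hab i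
  have h1 : ∀ k : ℕ, q * b * a * q ^ k ≠ 1 := fun k => by
    have := hab (k + 1)
    rwa [show a * b * q ^ (k + 1) = q * b * a * q ^ k by ring] at this
  rw [mu_lauP_mul_lauP hq hq0 ha hb0 ha hb hab h1 hba rfl rfl]
  set M := m / 2 + n / 2 with hM
  have hpM := pow_ne_zero M hq0
  have hτ : a / (a * q ^ M) = (q ^ M)⁻¹ := by field_simp
  rw [hτ]
  have hterm : ∀ j ∈ range (m + 1), ¬(j = m ∧ m = n) → qBinom q m j * qBinom q n j *
          (qPoch q q j * qPoch (b / a) q j * qPoch (a * b) q j / qPoch (b ^ 2) q j *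
            ((-(q ^ M)⁻¹) ^ j * q ^ (j.choose 2) *
              qPoch ((q ^ M)⁻¹ * q ^ j) q (m + n - 2 * j))) = 0 := by
    intro j hj hne
    have hjm : j ≤ m := by simpa [Nat.lt_succ_iff] using hj
    rcases qBinom_eq_zero_or_le q n j with h0 | hjn
    · rw [h0]; ring
    -- the factor of index `M - j` of `(q^{j-M}; q)_{m+n-2j}` is zero
    rw [qPoch_eq_zero (x := (q ^ M)⁻¹ * q ^ j) (k := M - j)]
    · ring
    · omega
    · rw [mul_assoc, ← pow_add, Nat.add_sub_cancel' (by omega), inv_mul_cancel₀ hpM]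
  split_ifs with hmn
  · subst hmn
    rw [sum_eq_single_of_mem m (self_mem_range_succ m) fun j hj hne => hterm j hj (by tauto)]
    rw [qBinom_self, show m + m - 2 * m = 0 by omega, qPoch_zero, normH,
      show q * b * a = a * b * q by ring]
    have hM2 : M = 2 * (m / 2) := by omega
    rw [show (m + 1) / 2 + (m + 1) / 2 = 2 * ((m + 1) / 2) by omega, ← hM2]
    have hev : (-1 : ℂ) ^ M = 1 := by rw [hM2, pow_mul]; simp
    have hqe : q ^ ((M + 1).choose 2) * q ^ (m.choose 2) = (q ^ M) ^ m := by
      rw [← pow_add, ← pow_mul]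
      congr 1
      have t1 := two_mul_choose_two_add M
      have t2 := two_mul_choose_two_add m
      have t3 := choose_two_succ M
      -- according to the parity of `m`
      have hcase : M = m ∨ M + 1 = m := by omega
      rcases hcase with h | h
      · rw [h] at t1 t3 ⊢; linarith
      · rw [← h] at t2 ⊢; nlinarith
    have hX' := hX m
    have hab' := habp m
    have hD1 : qPoch (a * b * q) q M ≠ 0 := qPoch_ne_zero_iff.2 fun i _ => by
      rw [show a * b * q = q * b * a by ring]; exact h1 i
    have hD2 : qPoch (b / a) q (2 * ((m + 1) / 2)) ≠ 0 := qPoch_ne_zero_iff.2 fun i _ => hba i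
    have hlead : (-a) ^ M * q ^ ((M + 1).choose 2) * ((-(q ^ M)⁻¹) ^ m * q ^ (m.choose 2)) =
        (-1) ^ m * a ^ M := by
      calc _ = ((-1) ^ M * a ^ M) * ((-1) ^ m * ((q ^ M) ^ m)⁻¹) *
            (q ^ ((M + 1).choose 2) * q ^ (m.choose 2)) := by
            rw [neg_pow a, neg_pow (q ^ M)⁻¹, inv_pow]; ring
        _ = _ := by
            rw [hqe, hev]
            have := pow_ne_zero m hpM
            field_simp
    rw [← hlead]
    generalize qPoch (a * b * q) q M = u1 at *
    generalize qPoch (b / a) q (2 * ((m + 1) / 2)) = u2 at *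
    generalize qPoch (a * b) q m = u3 at *
    generalize qPoch (b ^ 2) q m = u4 at *
    generalize (-(q ^ M)⁻¹) ^ m = u5 at *
    field_simp
  · rw [sum_eq_zero fun j hj => hterm j hj (by tauto), mul_zero]

/-- The sum in `mu_lauP_mul_lauP` as a terminating `₄φ₃`. -/
lemma sum_eq_basicHyp {a b c q : ℂ} (hq : ‖q‖ < 1) (hq0 : q ≠ 0) (ha : a ≠ 0)
    (hc : c ≠ 0) (hb : ‖b‖ < 1)
    {m n M N : ℕ} (hMN : M + N = m + n)
    (hM0 : qPoch (q ^ (-(M : ℤ)) * a / c) q (min m n) ≠ 0)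
    (hN0 : qPoch (q ^ (1 - (N : ℤ)) * c / a) q (min m n) ≠ 0) :
    (-c) ^ M * q ^ ((M + 1).choose 2) *
        ∑ j ∈ range (m + 1), qBinom q m j * qBinom q n j *
          (qPoch q q j * qPoch (b / a) q j * qPoch (a * b) q j / qPoch (b ^ 2) q j *
            ((-(a / (c * q ^ M))) ^ j * q ^ (j.choose 2) *
              qPoch (a / (c * q ^ M) * q ^ j) q (m + n - 2 * j))) =
      a ^ M * (qPoch (q * c / a) q M * qPoch (a / c) q N) *
        basicHyp [q ^ (-(m : ℤ)), q ^ (-(n : ℤ)), a * b, b / a]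
          [b ^ 2, q ^ (-(M : ℤ)) * a / c, q ^ (1 - (N : ℤ)) * c / a] q q := by
  have hb2 : ‖b ^ 2‖ < 1 := by
    rw [norm_pow]; exact pow_lt_one₀ (norm_nonneg _) hb two_ne_zero
  have hqp : ∀ k, qPoch q q k ≠ 0 := qPoch_ne_zero_of_norm_lt hq hq
  have hX : ∀ k, qPoch (b ^ 2) q k ≠ 0 := qPoch_ne_zero_of_norm_lt hq hb2
  have hpM := pow_ne_zero M hq0
  set τ := a / (c * q ^ M) with hτ
  have hτ0 : τ ≠ 0 := div_ne_zero ha (mul_ne_zero hc hpM)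
  have hτ' : q ^ (-(M : ℤ)) * a / c = τ := by
    rw [hτ, zpow_neg, zpow_natCast]; field_simp
  have hσ' : q ^ (1 - (N : ℤ)) * c / a = q / (τ * q ^ (m + n)) := by
    rw [hτ, zpow_sub₀ hq0, zpow_one, zpow_natCast, ← hMN, pow_add]; field_simp
  rw [hτ'] at hM0 ⊢
  rw [hσ'] at hN0 ⊢
  -- `(τ; q)_{m+n}`, the common factor taken out of the terms of the sum
  have hpre : (-c) ^ M * q ^ ((M + 1).choose 2) * qPoch τ q (m + n) =
      a ^ M * (qPoch (q * c / a) q M * qPoch (a / c) q N) := by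
    have h1 := qPoch_reverse hτ0 hq0 M M le_rfl
    rw [Nat.sub_self, show q / (τ * q ^ M) = q * c / a by rw [hτ]; field_simp] at h1
    simp only [Nat.choose_zero_succ, pow_zero, mul_one, one_mul] at h1
    rw [← hMN, qPoch_add, show τ * q ^ M = a / c by rw [hτ]; field_simp, ← h1]
    have e : q ^ ((M + 1).choose 2) * q ^ (M.choose 2) = (q ^ M) ^ M := by
      rw [← pow_add, ← pow_mul]
      congr 1
      rw [choose_two_succ]; linarith [two_mul_choose_two_add M]
    calc _ = ((-c) ^ M * (-τ) ^ M * (q ^ ((M + 1).choose 2) * q ^ (M.choose 2))) *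
          (qPoch (q * c / a) q M * qPoch (a / c) q N) := by ring
      _ = _ := by
          rw [e, ← mul_pow, ← mul_pow, show -c * -τ * q ^ M = a by rw [hτ]; field_simp]
  rw [← hpre, mul_assoc, mul_assoc, mul_assoc]
  congr 2
  rw [basicHyp, tsum_eq_sum (s := range (m + 1)), mul_sum]
  · refine sum_congr rfl fun j hj => ?_
    simp only [List.map_cons, List.map_nil, List.prod_cons, List.prod_nil, mul_one]
    have hjm : j ≤ m := by simpa [Nat.lt_succ_iff] using hj
    -- beyond `min m n` the denominators may vanish, but the numerators do
    rcases Nat.lt_or_ge n j with hnj | hjn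
    · rw [qBinom_eq_zero q hnj, qPoch_neg_pow_eq_zero hq0 hnj]; ring
    have d1 := hqp j
    have d2 := hX j
    have d3 := qPoch_ne_zero_of_le (le_min hjm hjn) hM0
    have d4 := qPoch_ne_zero_of_le (le_min hjm hjn) hN0
    have e1 := qPoch_neg_pow (n := m) hq0 j
    have e2 := qPoch_neg_pow (n := n) hq0 j
    have e3 := qPoch_reverse hτ0 hq0 (m + n) j (by omega)
    have e4 : qPoch τ q (m + n) = qPoch τ q j * qPoch (τ * q ^ j) q (m + n - 2 * j) *
        qPoch (τ * q ^ (m + n - j)) q j := by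
      rw [← qPoch_add, show m + n - j = j + (m + n - 2 * j) by omega, ← qPoch_add]
      congr 1
      omega
    have e5 : q ^ (j.choose 2) * q ^ (j.choose 2) * q ^ ((m + n).choose 2) * q ^ j =
        q ^ (m * j) * q ^ (n * j) * q ^ ((m + n - j).choose 2) * q ^ (j.choose 2) := by
      obtain ⟨d, hd⟩ := Nat.exists_eq_add_of_le (show j ≤ m + n by omega)
      rw [← pow_add, ← pow_add, ← pow_add, ← pow_add, ← pow_add, ← pow_add, hd,
        Nat.add_sub_cancel_left, choose_two_add, ← add_mul, hd]
      congr 1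
      linarith [two_mul_choose_two_add j]
    have hsq : (-1 : ℂ) ^ j * (-1) ^ j = 1 := by rw [← mul_pow]; simp
    have hN : q ^ (m * j) * q ^ (n * j) * q ^ ((m + n - j).choose 2) ≠ 0 :=
      mul_ne_zero (mul_ne_zero (pow_ne_zero _ hq0) (pow_ne_zero _ hq0)) (pow_ne_zero _ hq0)
    rw [e4]
    set Sm := qPoch (q ^ (-(m : ℤ))) q j
    set Sn := qPoch (q ^ (-(n : ℤ))) q j
    set D := qPoch (q / (τ * q ^ (m + n))) q j
    set W := qPoch (τ * q ^ (m + n - j)) q j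
    set T := qPoch τ q j
    set V := qPoch (τ * q ^ j) q (m + n - 2 * j)
    set Q := qPoch q q j
    set Xj := qPoch (b ^ 2) q j
    have key : qBinom q m j * qBinom q n j * Q * Q * ((-τ) ^ j * q ^ (j.choose 2)) * D =
        W * (Sm * Sn) * q ^ j := by
      apply mul_left_cancel₀ hN
      calc _ = (q ^ (m * j) * q ^ (n * j) * q ^ ((m + n - j).choose 2) * q ^ (j.choose 2)) *
            (qBinom q m j * qBinom q n j * Q * Q * (-τ) ^ j * D) * ((-1) ^ j * (-1) ^ j) := by
            rw [hsq]; ring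
        _ = (q ^ (j.choose 2) * qBinom q m j * Q * (-1) ^ j) *
            (q ^ (j.choose 2) * qBinom q n j * Q * (-1) ^ j) *
            ((-τ) ^ j * q ^ ((m + n).choose 2) * D) * q ^ j := by rw [← e5]; ring
        _ = _ := by rw [e1, e2, e3]; ring
    have hred : ∀ A B : ℂ, T * V * W * (Sm * (Sn * (B * A)) / (Q * (Xj * (T * D))) * q ^ j) =
        (W * (Sm * Sn) * q ^ j) * (V * A * B / (Q * Xj * D)) := by
      intro A B
      field_simp
    rw [hred, ← key]
    field_simp
  · intro k hk
    simp only [List.map_cons, List.prod_cons]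
    rw [qPoch_neg_pow_eq_zero hq0 (n := m) (by simpa using hk)]
    simp

/-! ### Orthogonality on the unit circle -/

/-- The case `m = 0` of `circleMean_rogersSum_mul`, where the sum reduces to `(τ; q)_n` with
`τ = a / (c q^d)`. -/
lemma circleMean_zpow_neg_mul_rogersSum {a b c q : ℂ} (hq : ‖q‖ < 1) (hq0 : q ≠ 0) (ha : a ≠ 0)
    (hb0 : b ≠ 0) (hc : c ≠ 0) (hb : ‖b‖ < 1) {d n i : ℕ} (hi : i < n)
    (h : a / (c * q ^ d) * q ^ i = 1) :
    circleMean (fun z => z ^ (-(d : ℤ)) * rogersSum q (b / a) (a * b) n (a * z) *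
      weight c b q z) = 0 := by
  have hcd : c * q ^ d ≠ 0 := mul_ne_zero hc (pow_ne_zero d hq0)
  have hG := circleMean_rogersSum_mul hq hq0 ha hb0 hcd hb 0 n
  have hint : circleMean (fun z => z ^ (-(d : ℤ)) * rogersSum q (b / a) (a * b) n (a * z) *
      weight c b q z) = (-c) ^ d * q ^ ((d + 1).choose 2) *
      circleMean (fun z => rogersSum q (b / a) (a * b) 0 (a * z) *
        rogersSum q (b / a) (a * b) n (a * z) * genWeight b b (c * q ^ d) q z) := by
    rw [← circleMean_const_mul]
    refine circleMean_congr fun z hz => ?_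
    have hz0 := ne_zero_of_norm_one hz
    rw [weight_eq_genWeight, genWeight_mul_pow_c b b hq hq0 hc hz0 d, zpow_neg, zpow_natCast]
    have := pow_ne_zero d hz0
    simp only [rogersSum, zero_add, sum_range_one, qBinom_zero_right, qPoch_zero, pow_zero,
      Nat.sub_zero, mul_one, one_mul]
    field_simp
  have hz : qPoch (a / (c * q ^ d)) q n = 0 := qPoch_eq_zero hi h
  rw [zero_add, sum_range_one] at hG
  simp only [pow_zero, mul_one, Nat.choose_zero_succ, Nat.sub_zero, hz,
    mul_zero] at hG
  have hb2 : ‖b ^ 2‖ < 1 := by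
    rw [norm_pow]; exact pow_lt_one₀ (norm_nonneg _) hb two_ne_zero
  have hne := mul_ne_zero (qPochInf_ne_zero_of_norm_lt hq hq) (qPochInf_ne_zero_of_norm_lt hq hb2)
  rw [hint, (mul_eq_zero.1 hG).resolve_left hne, mul_zero]

lemma polyP_inv_eq_sum {a b q : ℂ} (ha : a ≠ 0) (hb : b ≠ 0) (hq0 : q ≠ 0) {n : ℕ}
    (hqn : qPoch q q n ≠ 0) (hab : qPoch (a * b) q n ≠ 0) {z : ℂ} (hz : z ≠ 0) :
    polyP a b q n z⁻¹ = ∑ k ∈ range (n + 1), qBinom q n k * (qPoch (b / a) q k *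
      qPoch (a * b) q (n - k) * a ^ k) / qPoch (a * b) q n * z ^ (-(k : ℤ)) := by
  rw [polyP_eq ha hb hq0 hqn hab (inv_ne_zero hz), rogersSum, sum_div]
  refine sum_congr rfl fun k _ => ?_
  rw [mul_pow, zpow_neg, zpow_natCast, inv_pow]
  ring

lemma circleMean_zpow_neg_mul_polyP {a b q : ℂ} (hq : ‖q‖ < 1) (hq0 : q ≠ 0) (ha : a ≠ 0)
    (hb0 : b ≠ 0) (hb : ‖b‖ < 1) (hab : ∀ k : ℕ, a * b * q ^ k ≠ 1) {n k : ℕ} (hk : k < n) :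
    circleMean (fun z => z ^ (-(k : ℤ)) * polyP a b q n z * weight a b q z) = 0 := by
  have habp : ∀ k, qPoch (a * b) q k ≠ 0 := fun k => qPoch_ne_zero_iff.2 fun i _ => hab i
  have h := circleMean_zpow_neg_mul_rogersSum hq hq0 ha hb0 ha hb hk (d := k)
    (by have := pow_ne_zero k hq0; field_simp)
  rw [← mul_zero (qPoch (a * b) q n)⁻¹, ← h, ← circleMean_const_mul]
  refine circleMean_congr fun z hz => ?_
  rw [polyP_eq ha hb0 hq0 (qPoch_ne_zero_of_norm_lt hq hq n) (habp n) (ne_zero_of_norm_one hz)]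
  ring

lemma continuousOn_zpow_mul_weight {a b q : ℂ} (hq : ‖q‖ < 1) (ha : a ≠ 0) (hb : ‖b‖ < 1)
    (k : ℤ) {f : ℂ → ℂ} (hf : ContinuousOn f (Metric.sphere 0 1)) :
    ContinuousOn (fun z => z ^ k * f z * weight a b q z) (Metric.sphere 0 1) := by
  refine continuousOn_mul_genWeight hq ha hb hb (ContinuousOn.mul (fun z hz => ?_) hf)
  exact (continuousAt_zpow₀ z k
    (Or.inl (ne_zero_of_norm_one (by simpa using hz)))).continuousWithinAt

lemma continuous_rogersSum (q A B a : ℂ) (n : ℕ) :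
    Continuous fun z => rogersSum q A B n (a * z) := by
  unfold rogersSum; fun_prop

lemma continuousOn_polyP {a b q : ℂ} (ha : a ≠ 0) (hb : b ≠ 0) (hq0 : q ≠ 0) {n : ℕ}
    (hqn : qPoch q q n ≠ 0) (hab : qPoch (a * b) q n ≠ 0) :
    ContinuousOn (polyP a b q n) (Metric.sphere 0 1) :=
  ((continuous_rogersSum q (b / a) (a * b) a n).div_const (qPoch (a * b) q n)).continuousOn.congr
    fun _ hz => polyP_eq ha hb hq0 hqn hab (ne_zero_of_norm_one (by simpa using hz))

/-- `p_m` is orthogonal to every polynomial of degree `< m` in `1/z`; the second parameter `a'` is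
therefore arbitrary. -/
lemma circleMean_polyP_mul_polyP_inv {a a' b q : ℂ} (hq : ‖q‖ < 1) (hq0 : q ≠ 0) (ha : a ≠ 0)
    (ha' : a' ≠ 0) (hb0 : b ≠ 0) (hb : ‖b‖ < 1) (hab : ∀ k : ℕ, a * b * q ^ k ≠ 1)
    (hab' : ∀ k : ℕ, a' * b * q ^ k ≠ 1) {m n : ℕ} (hnm : n < m) :
    circleMean (fun z => polyP a b q m z * polyP a' b q n z⁻¹ * weight a b q z) = 0 := by
  have hqp : ∀ k, qPoch q q k ≠ 0 := qPoch_ne_zero_of_norm_lt hq hq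
  have habp : ∀ k, qPoch (a * b) q k ≠ 0 := fun k => qPoch_ne_zero_iff.2 fun i _ => hab i
  have habp' : ∀ k, qPoch (a' * b) q k ≠ 0 := fun k => qPoch_ne_zero_iff.2 fun i _ => hab' i
  set r : ℕ → ℂ := fun k => qBinom q n k * (qPoch (b / a') q k *
      qPoch (a' * b) q (n - k) * a' ^ k) / qPoch (a' * b) q n with hr
  have e : circleMean (fun z => polyP a b q m z * polyP a' b q n z⁻¹ * weight a b q z) =
      circleMean (fun z => ∑ k ∈ range (n + 1),
        r k * (z ^ (-(k : ℤ)) * polyP a b q m z * weight a b q z)) := by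
    refine circleMean_congr fun z hz => ?_
    rw [polyP_inv_eq_sum ha' hb0 hq0 (hqp n) (habp' n) (ne_zero_of_norm_one hz), mul_sum, sum_mul]
    exact sum_congr rfl fun k _ => by rw [hr]; ring
  rw [e, circleMean_sum]
  · refine sum_eq_zero fun k hk => ?_
    rw [circleMean_const_mul, circleMean_zpow_neg_mul_polyP hq hq0 ha hb0 hb hab, mul_zero]
    have := mem_range.1 hk
    omega
  · exact fun k _ => (continuousOn_zpow_mul_weight hq ha hb _
      (continuousOn_polyP ha hb0 hq0 (hqp m) (habp m))).const_mul _

/-- `p_n^{(1/(qa), b; q)}(1/z)` is orthogonal to every polynomial of degree `< n` in `z`: up to a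
factor it is `z⁻ⁿ p_n^{(qa, b; q)}(z)`. -/
lemma circleMean_polyP_mul_polyP_inv_of_lt {a b q : ℂ} (hq : ‖q‖ < 1) (hq0 : q ≠ 0) (ha : a ≠ 0)
    (hb0 : b ≠ 0) (hb : ‖b‖ < 1) (hab : ∀ k : ℕ, a * b * q ^ k ≠ 1)
    (hab' : ∀ k : ℕ, 1 / (q * a) * b * q ^ k ≠ 1) {m n : ℕ} (hmn : m < n) :
    circleMean (fun z => polyP a b q m z * polyP (1 / (q * a)) b q n z⁻¹ *
      weight a b q z) = 0 := by
  have hqp : ∀ k, qPoch q q k ≠ 0 := qPoch_ne_zero_of_norm_lt hq hq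
  have habp : ∀ k, qPoch (a * b) q k ≠ 0 := fun k => qPoch_ne_zero_iff.2 fun i _ => hab i
  have habp' : ∀ k, qPoch (1 / (q * a) * b) q k ≠ 0 :=
    fun k => qPoch_ne_zero_iff.2 fun i _ => hab' i
  have hqa : q * a ≠ 0 := mul_ne_zero hq0 ha
  set r : ℕ → ℂ := fun k => qBinom q m k * (qPoch (b / a) q k *
      qPoch (a * b) q (m - k) * a ^ k) / qPoch (a * b) q m *
      ((1 / (q * a)) ^ n / qPoch (1 / (q * a) * b) q n) with hr
  have e : circleMean (fun z => polyP a b q m z * polyP (1 / (q * a)) b q n z⁻¹ *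
      weight a b q z) =
      circleMean (fun z => ∑ k ∈ range (m + 1),
        r k * (z ^ (-((n - k : ℕ) : ℤ)) * rogersSum q (b / (q * a)) (q * a * b) n (q * a * z) *
          weight a b q z)) := by
    refine circleMean_congr fun z hz => ?_
    have hz0 := ne_zero_of_norm_one hz
    rw [polyP_eq ha hb0 hq0 (hqp m) (habp m) hz0,
      polyP_eq (one_div_ne_zero hqa) hb0 hq0 (hqp n) (habp' n) (inv_ne_zero hz0),
      rogersSum_reverse (hqp n) _ _ (mul_ne_zero (one_div_ne_zero hqa) (inv_ne_zero hz0)),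
      show (1 / (q * a) * z⁻¹)⁻¹ = q * a * z by field_simp,
      show 1 / (q * a) * b = b / (q * a) by ring,
      show b / (1 / (q * a)) = q * a * b by field_simp, rogersSum, sum_div, sum_mul, sum_mul]
    refine sum_congr rfl fun k hk => ?_
    have hk : k ≤ m := by simpa [Nat.lt_succ_iff] using hk
    have hzp : z ^ (-((n - k : ℕ) : ℤ)) = z ^ k * (z ^ n)⁻¹ := by
      rw [zpow_neg, zpow_natCast, pow_sub₀ z hz0 (by omega), mul_inv, inv_inv, mul_comm]
    rw [hzp, hr, mul_pow, mul_pow, inv_pow, show 1 / (q * a) * b = b / (q * a) by ring]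
    ring
  rw [e, circleMean_sum]
  · refine sum_eq_zero fun k hk => ?_
    have hk : k ≤ m := by simpa [Nat.lt_succ_iff] using hk
    rw [circleMean_const_mul, circleMean_zpow_neg_mul_rogersSum hq hq0 hqa hb0 ha hb
      (i := n - k - 1) (by omega), mul_zero]
    obtain ⟨d, hd⟩ := Nat.exists_eq_add_of_le (show 1 ≤ n - k by omega)
    rw [hd, Nat.add_sub_cancel_left, pow_add, pow_one]
    have := pow_ne_zero d hq0
    field_simp
  · exact fun k _ => (continuousOn_zpow_mul_weight hq ha hb _
      (continuous_rogersSum _ _ _ _ n).continuousOn).const_mul _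

/-! ### Equivalence of the orthogonality conditions -/

/-- A triangular linear system with non-zero diagonal has only the trivial solution. -/
lemma forall_sum_eq_zero_iff {c : ℕ → ℕ → ℂ} (hc : ∀ m, c m m ≠ 0) (x : ℕ → ℂ) (n : ℕ) :
    (∀ m < n, ∑ k ∈ range (m + 1), c m k * x k = 0) ↔ ∀ k < n, x k = 0 := by
  constructor
  · intro h k
    induction k using Nat.strong_induction_on with
    | _ k ih =>
      intro hk
      have h1 := h k hk
      rw [sum_range_succ, sum_eq_zero, zero_add] at h1
      · exact (mul_eq_zero.1 h1).resolve_left (hc k)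
      · intro i hi
        have := mem_range.1 hi
        rw [ih i this (this.trans hk), mul_zero]
  · intro h m hm
    refine sum_eq_zero fun k hk => ?_
    have := mem_range.1 hk
    rw [h k (by omega), mul_zero]

/-- Multiplying `P_n` by the first `n` of the monomials `1, z, z⁻¹, z², …` gives `z^{-k} p_n` for
`k = 0, …, n - 1`. -/
lemma forall_lauExp_sub_iff (n : ℕ) (p : ℤ → Prop) :
    (∀ k < n, p (lauExp k - (n / 2 : ℕ))) ↔ ∀ k < n, p (-(k : ℤ)) := by
  constructor
  · intro h j hj
    have := h (if n / 2 ≤ j then 2 * (j - n / 2) else 2 * (n / 2 - j) - 1)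
      (by split_ifs <;> omega)
    convert this using 1
    simp only [lauExp, Nat.even_iff]
    split_ifs <;> omega
  · intro h k hk
    have := h ((n / 2 : ℕ) - lauExp k).toNat (by
      simp only [lauExp, Nat.even_iff]
      split_ifs <;> omega)
    convert this using 1
    simp only [lauExp, Nat.even_iff]
    split_ifs <;> omega

/-- For fixed `n`, the conditions `L(P_m P_n) = 0`, `m < n`, form a triangular system in the values
of `L` on the products of `P_n` with monomials. -/
lemma functional_lauP_iff {a b q : ℂ} (ha : a ≠ 0) (hb : b ≠ 0) (hq0 : q ≠ 0)
    (hqn : ∀ n, qPoch q q n ≠ 0) (hab : ∀ n, qPoch (a * b) q n ≠ 0)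
    (hba : ∀ n, qPoch (b / a) q n ≠ 0) (L : (ℂˣ → ℂ) →ₗ[ℂ] ℂ) :
    (∀ m n : ℕ, m ≠ n → L (fun z => lauP a b q m z * lauP a b q n z) = 0) ↔
      (∀ n k : ℕ, k < n → L (fun z => (z : ℂ) ^ (-(k : ℤ)) * polyP a b q n z) = 0) := by
  have hmon : ∀ m, ∃ c : ℕ → ℂ, c m ≠ 0 ∧ ∀ z : ℂ, z ≠ 0 →
      lauP a b q m z = ∑ k ∈ range (m + 1), c k * z ^ lauExp k := by
    intro m
    obtain ⟨c, hc1, hc⟩ := isMonicLaurent_lauP ha hb hq0 (hqn m) (hab m) fun _ => hba m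
    have hC := leadC_ne_zero ha (hab m) fun _ => hba m
    refine ⟨fun k => leadC a b q m * c k, by simp [hc1, hC], fun z hz => ?_⟩
    have h := hc z hz
    rw [div_eq_iff hC] at h
    rw [h, sum_mul]
    exact sum_congr rfl fun k _ => by ring
  choose c hc0 hc using hmon
  set φ : ℕ → ℤ → ℂ := fun n e => L (fun z => (z : ℂ) ^ e * polyP a b q n z) with hφ
  have hL : ∀ m n, L (fun z => lauP a b q m z * lauP a b q n z) =
      ∑ k ∈ range (m + 1), c m k * φ n (lauExp k - (n / 2 : ℕ)) := by
    intro m n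
    have e : (fun z : ℂˣ => lauP a b q m z * lauP a b q n z) =
        ∑ k ∈ range (m + 1), c m k •
          (fun z : ℂˣ => (z : ℂ) ^ (lauExp k - (n / 2 : ℕ)) * polyP a b q n z) := by
      ext z
      rw [hc m z z.ne_zero, lauP_eq_zpow_mul_polyP a b q n z.ne_zero, sum_mul, Finset.sum_apply]
      refine sum_congr rfl fun k _ => ?_
      rw [Pi.smul_apply, smul_eq_mul, sub_eq_add_neg, zpow_add₀ z.ne_zero]
      ring
    rw [e, map_sum]
    simp only [map_smul, smul_eq_mul, hφ]
  have h1 : (∀ m n : ℕ, m ≠ n → L (fun z => lauP a b q m z * lauP a b q n z) = 0) ↔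
      ∀ n, ∀ m < n, L (fun z => lauP a b q m z * lauP a b q n z) = 0 := by
    refine ⟨fun h n m hmn => h m n hmn.ne, fun h m n hmn => ?_⟩
    rcases Nat.lt_or_gt_of_ne hmn with h' | h'
    · exact h n m h'
    · simpa only [mul_comm] using h m n h'
  rw [h1]
  refine forall_congr' fun n => ?_
  simp only [hL]
  rw [forall_sum_eq_zero_iff hc0 (fun k => φ n (lauExp k - (n / 2 : ℕ))),
    forall_lauExp_sub_iff n fun e => φ n e = 0]

/-- For fixed `m`, the conditions `L(p_m(z) p_n(1/z)) = 0`, `n < m`, form a triangular system in the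
values `L(z^{-k} p_m(z))`. -/
lemma functional_polyP_inv_iff {a b q : ℂ} (ha : a ≠ 0) (hb : b ≠ 0) (hq0 : q ≠ 0)
    (hqn : ∀ n, qPoch q q n ≠ 0) (hab : ∀ n, qPoch (a * b) q n ≠ 0)
    (hba : ∀ n, qPoch (b / a) q n ≠ 0) (L : (ℂˣ → ℂ) →ₗ[ℂ] ℂ) :
    (∀ m n : ℕ, n < m → L (fun z => polyP a b q m z * polyP a b q n (z : ℂ)⁻¹) = 0) ↔
      (∀ n k : ℕ, k < n → L (fun z => (z : ℂ) ^ (-(k : ℤ)) * polyP a b q n z) = 0) := by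
  set r : ℕ → ℕ → ℂ := fun n k => qBinom q n k * (qPoch (b / a) q k *
      qPoch (a * b) q (n - k) * a ^ k) / qPoch (a * b) q n with hr
  have hr0 : ∀ n, r n n ≠ 0 := by
    intro n
    simp only [hr, qBinom_self, Nat.sub_self, qPoch_zero, one_mul, mul_one]
    exact div_ne_zero (mul_ne_zero (hba n) (pow_ne_zero n ha)) (hab n)
  have hL : ∀ m n, L (fun z => polyP a b q m z * polyP a b q n (z : ℂ)⁻¹) =
      ∑ k ∈ range (n + 1), r n k *
        L (fun z => (z : ℂ) ^ (-(k : ℤ)) * polyP a b q m z) := by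
    intro m n
    have e : (fun z : ℂˣ => polyP a b q m z * polyP a b q n (z : ℂ)⁻¹) =
        ∑ k ∈ range (n + 1), r n k •
          (fun z : ℂˣ => (z : ℂ) ^ (-(k : ℤ)) * polyP a b q m z) := by
      ext z
      rw [polyP_inv_eq_sum ha hb hq0 (hqn n) (hab n) z.ne_zero, mul_sum, Finset.sum_apply]
      refine sum_congr rfl fun k _ => ?_
      rw [Pi.smul_apply, smul_eq_mul]
      ring
    rw [e, map_sum]
    simp only [map_smul, smul_eq_mul]
  refine forall_congr' fun m => ?_
  simp only [hL]
  exact forall_sum_eq_zero_iff hr0 _ m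

end PastroLaurent

end

theorem mainTheorem11 (a b q : ℂ) (ha : a ≠ 0) (hb : b ≠ 0) (hq : q ≠ 0) :
    -- `P_n / C_n` is a monic Laurent polynomial of degree `n`
    (∀ n : ℕ, PastroLaurent.qPoch q q n ≠ 0 → PastroLaurent.qPoch (a * b) q n ≠ 0 →
      (Odd n → PastroLaurent.qPoch (b / a) q n ≠ 0) →
      PastroLaurent.IsMonicLaurent
        (fun z => PastroLaurent.lauP a b q n z / PastroLaurent.leadC a b q n) n) ∧
    (‖q‖ < 1 → ‖b‖ < 1 → (∀ k : ℕ, a * b * q ^ k ≠ 1) →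
      ((∀ k : ℕ, b / a * q ^ k ≠ 1) →
        -- orthogonality for `μ_{a,b}`
        (∀ m n : ℕ,
          PastroLaurent.mu a b q
              (fun z => PastroLaurent.lauP a b q m z * PastroLaurent.lauP a b q n z) =
            if m = n then PastroLaurent.normH a b q n else 0) ∧
        -- equivalence with orthogonality of Pastro's type, for an arbitrary functional
        (∀ L : (ℂˣ → ℂ) →ₗ[ℂ] ℂ,
          ((∀ m n : ℕ, m ≠ n →
              L (fun z => PastroLaurent.lauP a b q m z * PastroLaurent.lauP a b q n z) = 0) ↔
            (∀ n k : ℕ, k < n →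
              L (fun z => (z : ℂ) ^ (-(k : ℤ)) * PastroLaurent.polyP a b q n z) = 0)) ∧
          ((∀ m n : ℕ, m ≠ n →
              L (fun z => PastroLaurent.lauP a b q m z * PastroLaurent.lauP a b q n z) = 0) ↔
            (∀ m n : ℕ, n < m →
              L (fun z => PastroLaurent.polyP a b q m z *
                PastroLaurent.polyP a b q n (z : ℂ)⁻¹) = 0))) ∧
        -- the resulting orthogonality relations on the unit circle
        (∀ n k : ℕ, k < n →
          PastroLaurent.mu a b q
            (fun z => z ^ (-(k : ℤ)) * PastroLaurent.polyP a b q n z) = 0) ∧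
        (∀ m n : ℕ, n < m →
          PastroLaurent.circleMean (fun z => PastroLaurent.polyP a b q m z *
            PastroLaurent.polyP a b q n z⁻¹ * PastroLaurent.weight a b q z) = 0) ∧
        (b ≠ q * a → ∀ m n : ℕ, m ≠ n →
          PastroLaurent.circleMean (fun z => PastroLaurent.polyP a b q m z *
            PastroLaurent.polyP (1 / (q * a)) b q n z⁻¹ *
              PastroLaurent.weight a b q z) = 0)) ∧
      -- the values of `μ_{c,b}`
      (∀ c : ℂ, c ≠ 0 → (∀ k : ℕ, q * b * c * q ^ k ≠ 1) → (∀ k : ℕ, b / c * q ^ k ≠ 1) →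
        ∀ m n M N : ℕ, M = m / 2 + n / 2 → N = (m + 1) / 2 + (n + 1) / 2 →
          PastroLaurent.qPoch (q ^ (-(M : ℤ)) * a / c) q (min m n) ≠ 0 →
          PastroLaurent.qPoch (q ^ (1 - (N : ℤ)) * c / a) q (min m n) ≠ 0 →
          PastroLaurent.mu c b q
              (fun z => PastroLaurent.lauP a b q m z * PastroLaurent.lauP a b q n z) =
            a ^ M *
              ((PastroLaurent.qPoch (b ^ 2) q m * PastroLaurent.qPoch (b ^ 2) q n *
                  PastroLaurent.qPoch (q * c / a) q M * PastroLaurent.qPoch (a / c) q N) /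
                (PastroLaurent.qPoch (a * b) q m * PastroLaurent.qPoch (a * b) q n *
                  PastroLaurent.qPoch (q * b * c) q M * PastroLaurent.qPoch (b / c) q N)) *
              PastroLaurent.basicHyp
                [q ^ (-(m : ℤ)), q ^ (-(n : ℤ)), a * b, b / a]
                [b ^ 2, q ^ (-(M : ℤ)) * a / c, q ^ (1 - (N : ℤ)) * c / a] q q)) := by
  refine ⟨fun n hqn hab hA => PastroLaurent.isMonicLaurent_lauP ha hb hq hqn hab hA,
    fun hq1 hb1 hab => ⟨fun hba => ?_, ?_⟩⟩
  · have hqp : ∀ n, PastroLaurent.qPoch q q n ≠ 0 :=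
      PastroLaurent.qPoch_ne_zero_of_norm_lt hq1 hq1
    have habp : ∀ n, PastroLaurent.qPoch (a * b) q n ≠ 0 :=
      fun n => PastroLaurent.qPoch_ne_zero_iff.2 fun i _ => hab i
    have hbap : ∀ n, PastroLaurent.qPoch (b / a) q n ≠ 0 :=
      fun n => PastroLaurent.qPoch_ne_zero_iff.2 fun i _ => hba i
    refine ⟨PastroLaurent.mu_lauP_mul_lauP_self hq1 hq ha hb hb1 hab hba, fun L => ?_, ?_, ?_, ?_⟩
    · have h := PastroLaurent.functional_lauP_iff ha hb hq hqp habp hbap L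
      exact ⟨h, h.trans (PastroLaurent.functional_polyP_inv_iff ha hb hq hqp habp hbap L).symm⟩
    · intro n k hk
      rw [PastroLaurent.mu,
        PastroLaurent.circleMean_zpow_neg_mul_polyP hq1 hq ha hb hb1 hab hk, mul_zero]
    · intro m n hnm
      exact PastroLaurent.circleMean_polyP_mul_polyP_inv hq1 hq ha ha hb hb1 hab hab hnm
    · intro hbqa m n hmn
      have hab' : ∀ k : ℕ, 1 / (q * a) * b * q ^ k ≠ 1 := by
        intro k h
        rcases k with _ | k
        · rw [pow_zero, mul_one, one_div_mul_eq_div, div_eq_one_iff_eq (mul_ne_zero hq ha)] at h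
          exact hbqa h
        · refine hba k ?_
          rw [← h, pow_succ]
          field_simp
      rcases Nat.lt_or_gt_of_ne hmn with h | h
      · exact PastroLaurent.circleMean_polyP_mul_polyP_inv_of_lt hq1 hq ha hb hb1 hab hab' h
      · exact PastroLaurent.circleMean_polyP_mul_polyP_inv hq1 hq ha
          (one_div_ne_zero (mul_ne_zero hq ha)) hb hb1 hab hab' h
  · intro c hc h1 h2 m n M N hM hN hM0 hN0
    rw [PastroLaurent.mu_lauP_mul_lauP hq1 hq ha hb hc hb1 hab h1 h2 hM hN, mul_right_comm,
      PastroLaurent.sum_eq_basicHyp hq1 hq ha hc hb1 (by omega) hM0 hN0]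
    ring
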